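/- Model. A port-numbered tree is a finite tree without node labels in which, at every node $v$, the incident edges carry distinct port numbers $0,\dots,\deg(v)-1$ (with no relation between the two ports of an edge). The view $V_T(x,r)$ of a node $x$ consists of the subtree induced by the nodes at distance at most $r$ from $x$, rooted at $x$, with all port numbers at these nodes and with the degrees of the nodes at distance exactly $r$, up to port-preserving isomorphism. In an algorithm with advice (LOCAL model) all nodes of $T$ get the same binary string; in each round $r=0,1,2,\dots$ a node $x$ decides, as a function of this string and of $V_T(x,r)$, whether to continue or to halt and output a sequence of port numbers. The algorithm solves leader election in $T$ in time $\tau$ if every node halts within $\tau$ rounds, and there is a common node (the leader) such that, for each node $x$, following the output of $x$ as outgoing ports from $x$ traverses a simple path ending at the leader. The size of advice is the length of the string, which an oracle chooses knowing the whole tree. Let $\xi(T)$ be the minimum time in which leader election in $T$ is feasible when all nodes are given the entire map of $T$ with its port numbers (but not their position in it), with $\xi(T)=\infty$ if it is not feasible. Double brooms. Let $D\ge 5$ be odd, $\delta$ an integer, and $f$ a bijection from $\{1,\dots,\delta^\delta\}$ onto $\{1,\dots,\delta\}^\delta$. For $1\le a<b\le\delta^\delta$ the double broom $DB_\delta(a,b)$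 consists of a path (the handle) of length $D-4$ with endpoints $v_a,v_b$ and port sequence $(0,0,1,1,0,0,\dots,1,1,0,0)$ along it; for each $z\in\{a,b\}$, with $f(z)=(z_1,\dots,z_\delta)$ and $z_{\delta+1}=\delta^2-\sum_{i\le\delta}z_i$, the node $v_z$ has $\delta+1$ further neighbours $w^z_1,\dots,w^z_{\delta+1}$, where the edge $\{v_z,w^z_i\}$ has port $i$ at $v_z$ and port $0$ at $w^z_i$, and $z_i$ leaves are attached to $w^z_i$ by edges with ports $1,\dots,z_i$ at $w^z_i$. Theorem. There are constants $c_1,c_2,c_3>0$ such that for all integers $3\le D<n$ with $D$ odd there is a class $\mathcal T$ of port-numbered trees with the following properties. 1. Every $T\in\mathcal T$ has size between $c_1n$ and $c_2n$, diameter exactly $D$, and $\xi(T)\le D-2$. 2. For every algorithm with advice and every choice of advice strings for the trees, if the algorithm solves leader election in time $D-2$ in every $T\in\mathcal T$, then some $T\in\mathcal T$ gets advice of size at least $c_3\log n$. Moreover, if $D\ge5$, then $\mathcal T$ can be taken to be the class of all double brooms $DB_\delta(a,b)$, $1\le a<b\le\delta^\delta$, of diameter $D$ for some $\delta$ and some $f$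 as above. -/

import Mathlib

/-- A finite tree with a local port numbering: at each node `v`, the edges incident to `v` carry
distinct port numbers from `{0, …, deg v - 1}`.  `port v u` is the port number at `v` of the edge
`{v, u}`; its value is irrelevant when `u` is not a neighbour of `v`.  Nodes have no labels that
an algorithm could see. -/
structure PortTree where
  /-- the nodes -/
  V : Type
  finite : Finite V
  /-- the underlying tree -/
  graph : SimpleGraph V
  isTree : graph.IsTree
  /-- the port numbers -/
  port : V → V → ℕ
  port_lt : ∀ v u, graph.Adj v u → port v u < (graph.neighborSet v).ncard
  port_inj : ∀ v u w, graph.Adj v u → graph.Adj v w → port v u = port v w → u = w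

namespace PortTree

instance (T : PortTree) : Finite T.V := T.finite

/-- The number of nodes. -/
noncomputable def size (T : PortTree) : ℕ := Nat.card T.V

/-- The diameter. -/
noncomputable def diam (T : PortTree) : ℕ := T.graph.diam

/-- The degree of a node. -/
noncomputable def degree (T : PortTree) (v : T.V) : ℕ := (T.graph.neighborSet v).ncard

/-- The nodes at distance at most `r` from `x`. -/
abbrev Ball (T : PortTree) (x : T.V) (r : ℕ) : Type := {y : T.V // T.graph.dist x y ≤ r}

/-- The root `x` as an element of the ball around it. -/
def ballRoot (T : PortTree) (x : T.V) (r : ℕ) : T.Ball x r := ⟨x, by simp⟩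

/-- `SameView r T x T' x'` says that `x` in `T` and `x'` in `T'` see the same within `r` rounds:
the subtrees induced by the nodes at distance at most `r` are isomorphic as rooted trees, with all
port numbers on their edges and the degrees (in the whole tree) of all their nodes, in
particular of those at distance exactly `r`. -/
def SameView (r : ℕ) (T : PortTree) (x : T.V) (T' : PortTree) (x' : T'.V) : Prop :=
  ∃ φ : T.Ball x r ≃ T'.Ball x' r,
    φ (T.ballRoot x r) = T'.ballRoot x' r ∧
    (∀ y z, T.graph.Adj y.1 z.1 ↔ T'.graph.Adj (φ y).1 (φ z).1) ∧
    (∀ y z, T.graph.Adj y.1 z.1 → T.port y.1 z.1 = T'.port (φ y).1 (φ z).1) ∧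
    (∀ y, T.degree y.1 = T'.degree (φ y).1)

/-- Having the same view within `r` rounds, as an equivalence relation on pairs (tree, node). -/
def viewSetoid (r : ℕ) : Setoid (Σ T : PortTree, T.V) where
  r p q := SameView r p.1 p.2 q.1 q.2
  iseqv :=
    { refl := fun p => ⟨Equiv.refl _, rfl, fun _ _ => Iff.rfl, fun _ _ _ => rfl, fun _ => rfl⟩
      symm := by
        rintro p q ⟨φ, h0, h1, h2, h3⟩
        refine ⟨φ.symm, by rw [← h0]; simp, fun y z => ?_, fun y z h => ?_, fun y => ?_⟩
        · simpa using (h1 (φ.symm y) (φ.symm z)).symm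
        · have := h2 (φ.symm y) (φ.symm z) ((h1 _ _).2 (by simpa using h))
          simpa using this.symm
        · simpa using (h3 (φ.symm y)).symm
      trans := by
        rintro p q s ⟨φ, h0, h1, h2, h3⟩ ⟨ψ, k0, k1, k2, k3⟩
        refine ⟨φ.trans ψ, by simp [h0, k0], fun y z => ?_, fun y z h => ?_, fun y => ?_⟩
        · exact (h1 y z).trans (k1 _ _)
        · exact (h2 y z h).trans (k2 _ _ ((h1 y z).1 h))
        · exact (h3 y).trans (k3 _) }

/-- The possible views within `r` rounds. -/
def View (r : ℕ) : Type 1 := Quotient (viewSetoid r)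

/-- The view acquired by node `x` of `T` within `r` rounds. -/
def view (T : PortTree) (x : T.V) (r : ℕ) : View r :=
  Quotient.mk (viewSetoid r) ⟨T, x⟩

/-- The sequence of outgoing ports along a walk. -/
def outPorts (T : PortTree) {x y : T.V} (p : T.graph.Walk x y) : List ℕ :=
  p.darts.map fun d => T.port d.fst d.snd

/-- Taking the entries of `P` as outgoing ports leads from `x` to `y` along a simple path. -/
def LeadsTo (T : PortTree) (x : T.V) (P : List ℕ) (y : T.V) : Prop :=
  ∃ p : T.graph.Walk x y, p.IsPath ∧ T.outPorts p = P

/-- A deterministic algorithm with advice in the LOCAL model.  At round `r = 0, 1, 2, …` every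
node decides, as a function of the advice string and of its view within `r` rounds, either to
continue (`none`) or to halt with an output sequence of port numbers. -/
def Algorithm : Type 1 := List Bool → (r : ℕ) → View r → Option (List ℕ)

/-- With advice `s`, node `x` of `T` halts in round `r` with output `P`. -/
def Algorithm.HaltsWith (A : Algorithm) (s : List Bool) (T : PortTree) (x : T.V)
    (r : ℕ) (P : List ℕ) : Prop :=
  A s r (T.view x r) = some P ∧ ∀ r' < r, A s r' (T.view x r') = none

/-- With advice `s`, algorithm `A` solves leader election in `T` in time `τ`: every node halts
within `τ` rounds, and all outputs code simple paths to a common node, the leader. -/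
def Algorithm.ElectsWithin (A : Algorithm) (s : List Bool) (T : PortTree) (τ : ℕ) : Prop :=
  ∃ leader : T.V, ∀ x : T.V, ∃ r ≤ τ, ∃ P, A.HaltsWith s T x r P ∧ T.LeadsTo x P leader

/-- The parameter `ξ(T)`: the minimum time in which leader election in `T` is feasible when every
node knows the map of `T` (but not its own position), that is, for an algorithm which may depend
on `T` and only has to be correct on `T`.  It is `⊤` if leader election in `T` is impossible. -/
noncomputable def xi (T : PortTree) : ℕ∞ :=
  ⨅ (τ : ℕ) (_ : ∃ A : Algorithm, A.ElectsWithin [] T τ), (τ : ℕ∞)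

end PortTree

/-! ### Double brooms -/

/-- The nodes of a double broom with a handle of length `2 * k + 1`.  The handle has the nodes
`handle 0, …, handle (2 * k + 1)`; its first endpoint belongs to side `false` and its last one to
side `true`.  On side `s` the endpoint has the `δ + 1` further neighbours `mid s i`, and `mid s i`
has the `N s i` further neighbours `leaf s i j`. -/
inductive BroomNode (k δ : ℕ) (N : Bool → Fin (δ + 1) → ℕ) : Type
  | handle (j : Fin (2 * k + 2)) : BroomNode k δ N
  | mid (s : Bool) (i : Fin (δ + 1)) : BroomNode k δ N
  | leaf (s : Bool) (i : Fin (δ + 1)) (j : Fin (N s i)) : BroomNode k δ N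

namespace BroomNode

variable {k δ : ℕ} {N : Bool → Fin (δ + 1) → ℕ}

/-- The endpoint of the handle on side `s`. -/
def handleEnd (k : ℕ) (s : Bool) : Fin (2 * k + 2) := if s then Fin.last _ else 0

/-- Auxiliary orientation of the edges towards `handle 0`: `IsParent u v` holds for the edges
`{u, v}` of the double broom, where `v` is the endpoint closer to `handle 0`. -/
def IsParent : BroomNode k δ N → BroomNode k δ N → Prop
  | handle j, handle j' => (j : ℕ) = j' + 1
  | mid s _, handle j => j = handleEnd k s
  | leaf s i _, mid s' i' => s = s' ∧ i = i'
  | _, _ => False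

/-- The underlying graph of a double broom. -/
def graph (k δ : ℕ) (N : Bool → Fin (δ + 1) → ℕ) : SimpleGraph (BroomNode k δ N) where
  Adj u v := IsParent u v ∨ IsParent v u
  symm := ⟨fun _ _ h => h.symm⟩
  loopless := ⟨by rintro (j | ⟨s, i⟩ | ⟨s, i, j⟩) <;> simp [IsParent]⟩

/-- The port numbers of a double broom.  The two ports of the `j`-th edge of the handle are both
`j mod 2`, so that the port sequence along the handle is `0,0,1,1,0,0,…,1,1,0,0`.  The ports at
an endpoint of the handle leading to the nodes `mid s i` are `1, …, δ + 1`, the ports at `mid s i`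
leading to leaves are `1, …, N s i`, and the ports of `mid s i` and of leaves that lead towards
the handle are `0`. -/
def port : BroomNode k δ N → BroomNode k δ N → ℕ
  | handle j, handle j' => min (j : ℕ) j' % 2
  | handle _, mid _ i => i + 1
  | mid _ _, leaf _ _ j => j + 1
  | _, _ => 0

instance : Finite (BroomNode k δ N) := by
  let F : Fin (2 * k + 2) ⊕ (Bool × Fin (δ + 1)) ⊕ (Σ p : Bool × Fin (δ + 1), Fin (N p.1 p.2)) →
      BroomNode k δ N := fun t => match t with
    | .inl j => handle j
    | .inr (.inl p) => mid p.1 p.2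
    | .inr (.inr q) => leaf q.1.1 q.1.2 q.2
  refine Finite.of_surjective F ?_
  rintro (j | ⟨s, i⟩ | ⟨s, i, j⟩)
  · exact ⟨.inl j, rfl⟩
  · exact ⟨.inr (.inl (s, i)), rfl⟩
  · exact ⟨.inr (.inr ⟨(s, i), j⟩), rfl⟩


theorem isTree_of_parent {V : Type} [Finite V] (G : SimpleGraph V) (R : V → V → Prop) (root : V)
    (rank : V → ℕ) (hadj : ∀ u v, G.Adj u v ↔ R u v ∨ R v u)
    (hrank : ∀ u v, R u v → rank v < rank u) (hroot : ∀ v, ¬ R root v)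
    (hex : ∀ u, u ≠ root → ∃ v, R u v) (huniq : ∀ u v w, R u v → R u w → v = w) : G.IsTree := by
  classical
  have hreach : ∀ n u, rank u ≤ n → G.Reachable u root := by
    intro n
    induction n with
    | zero =>
      intro u hu
      by_cases h : u = root
      · rw [h]
      · obtain ⟨v, hv⟩ := hex u h
        have := hrank u v hv
        omega
    | succ n ih =>
      intro u hu
      by_cases h : u = root
      · rw [h]
      · obtain ⟨v, hv⟩ := hex u h
        have h1 := hrank u v hv
        have h2 : G.Adj u v := (hadj u v).2 (Or.inl hv)
        exact h2.reachable.trans (ih v (by omega))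
  have : Nonempty V := ⟨root⟩
  rw [SimpleGraph.isTree_iff_connected_and_card]
  refine ⟨⟨fun u v => (hreach _ u le_rfl).trans (hreach _ v le_rfl).symm⟩, ?_⟩
  choose! par hpar using hex
  let F : {u : V // u ≠ root} → G.edgeSet := fun u =>
    ⟨s(u.1, par u.1), (hadj _ _).2 (Or.inl (hpar u.1 u.2))⟩
  have hF : Function.Bijective F := by
    constructor
    · rintro ⟨u, hu⟩ ⟨w, hw⟩ h
      have h' : s(u, par u) = s(w, par w) := congrArg Subtype.val h
      rw [Sym2.eq_iff] at h'
      rcases h' with ⟨h1, _⟩ | ⟨h1, h2⟩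
      · exact Subtype.ext h1
      · have r1 := hrank _ _ (hpar u hu)
        have r2 := hrank _ _ (hpar w hw)
        rw [h2] at r1
        rw [← h1] at r2
        omega
    · rintro ⟨e, he⟩
      induction e with
      | _ u v =>
        rcases (hadj u v).1 he with h | h
        · have hu : u ≠ root := by rintro rfl; exact hroot _ h
          exact ⟨⟨u, hu⟩, Subtype.ext (by simp [F, huniq _ _ _ (hpar u hu) h])⟩
        · have hv : v ≠ root := by rintro rfl; exact hroot _ h
          refine ⟨⟨v, hv⟩, Subtype.ext ?_⟩
          simp [F, huniq _ _ _ (hpar v hv) h]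
  rw [← Nat.card_congr (Equiv.ofBijective F hF)]
  have := Fintype.ofFinite V
  simp only [Nat.card_eq_fintype_card, Fintype.card_subtype_compl, Fintype.card_unique]
  have : 0 < Fintype.card V := Fintype.card_pos
  omega

theorem graph_isTree (k δ : ℕ) (N : Bool → Fin (δ + 1) → ℕ) : (graph k δ N).IsTree := by
  refine isTree_of_parent _ IsParent (handle 0)
    (fun u => match u with
      | handle j => (j : ℕ)
      | mid _ _ => 2 * k + 2
      | leaf _ _ _ => 2 * k + 3) (fun _ _ => Iff.rfl) ?_ ?_ ?_ ?_
  · rintro (⟨j, hj⟩ | ⟨s, i⟩ | ⟨s, i, j⟩) (⟨j', hj'⟩ | ⟨s', i'⟩ | ⟨s', i', j'⟩) <;>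
      simp [IsParent] <;> omega
  · rintro (j | ⟨s, i⟩ | ⟨s, i, j⟩) <;> simp [IsParent]
  · rintro (⟨j, hj⟩ | ⟨s, i⟩ | ⟨s, i, j⟩) h
    · rcases j with _ | j
      · exact absurd rfl h
      · exact ⟨handle ⟨j, by omega⟩, by simp [IsParent]⟩
    · exact ⟨handle (handleEnd k s), by simp [IsParent]⟩
    · exact ⟨mid s i, by simp [IsParent]⟩
  · rintro (⟨j, hj⟩ | ⟨s, i⟩ | ⟨s, i, j⟩) (⟨j1, hj1⟩ | ⟨s1, i1⟩ | ⟨s1, i1, j1⟩)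
      (⟨j2, hj2⟩ | ⟨s2, i2⟩ | ⟨s2, i2, j2⟩) <;> simp [IsParent]
    · omega
    · intro h1 h2
      have := h1.trans h2.symm
      simpa using this
    · rintro rfl rfl rfl rfl
      exact ⟨rfl, rfl⟩

theorem port_inj_handle (j : Fin (2 * k + 2)) (u w : BroomNode k δ N)
    (hu : (graph k δ N).Adj (handle j) u) (hw : (graph k δ N).Adj (handle j) w)
    (h : port (handle j) u = port (handle j) w) : u = w := by
  obtain ⟨j, hj⟩ := j
  rcases u with ⟨j1, hj1⟩ | ⟨s1, i1, hi1⟩ | ⟨s1, i1, l1⟩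
  · rcases w with ⟨j2, hj2⟩ | ⟨s2, i2, hi2⟩ | ⟨s2, i2, l2⟩
    · simp [graph, IsParent, port] at hu hw h ⊢
      omega
    · cases s2 <;> simp [graph, IsParent, port, handleEnd, Fin.ext_iff] at hu hw h <;> omega
    · simp [graph, IsParent] at hw
  · rcases w with ⟨j2, hj2⟩ | ⟨s2, i2, hi2⟩ | ⟨s2, i2, l2⟩
    · cases s1 <;> simp [graph, IsParent, port, handleEnd, Fin.ext_iff] at hu hw h <;> omega
    · cases s1 <;> cases s2 <;>
        simp [graph, IsParent, port, handleEnd, Fin.ext_iff] at hu hw h ⊢ <;> omega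
    · simp [graph, IsParent] at hw
  · simp [graph, IsParent] at hu

theorem port_inj_mid (s : Bool) (i : Fin (δ + 1)) (u w : BroomNode k δ N)
    (hu : (graph k δ N).Adj (mid s i) u) (hw : (graph k δ N).Adj (mid s i) w)
    (h : port (mid s i) u = port (mid s i) w) : u = w := by
  rcases u with j1 | ⟨s1, i1⟩ | ⟨s1, i1, l1⟩
  · rcases w with j2 | ⟨s2, i2⟩ | ⟨s2, i2, l2⟩
    · simp only [graph, IsParent, or_false] at hu hw
      rw [hu, hw]
    · simp [graph, IsParent] at hw
    · simp [port] at h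
  · simp [graph, IsParent] at hu
  · rcases w with j2 | ⟨s2, i2⟩ | ⟨s2, i2, l2⟩
    · simp [port] at h
    · simp [graph, IsParent] at hw
    · simp only [graph, IsParent, false_or] at hu hw
      obtain ⟨rfl, rfl⟩ := hu
      obtain ⟨rfl, rfl⟩ := hw
      simp only [port, Nat.add_right_cancel_iff] at h
      rw [Fin.ext h]

theorem port_inj_leaf (s : Bool) (i : Fin (δ + 1)) (j : Fin (N s i)) (u w : BroomNode k δ N)
    (hu : (graph k δ N).Adj (leaf s i j) u) (hw : (graph k δ N).Adj (leaf s i j) w) : u = w := by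
  rcases u with j1 | ⟨s1, i1⟩ | ⟨s1, i1, l1⟩
  · simp [graph, IsParent] at hu
  · rcases w with j2 | ⟨s2, i2⟩ | ⟨s2, i2, l2⟩
    · simp [graph, IsParent] at hw
    · simp only [graph, IsParent, or_false] at hu hw
      obtain ⟨rfl, rfl⟩ := hu
      obtain ⟨rfl, rfl⟩ := hw
      rfl
    · simp [graph, IsParent] at hw
  · simp [graph, IsParent] at hu

theorem port_inj : ∀ v u w : BroomNode k δ N, (graph k δ N).Adj v u → (graph k δ N).Adj v w →
    port v u = port v w → u = w
  | handle j, u, w, hu, hw, h => port_inj_handle j u w hu hw h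
  | mid s i, u, w, hu, hw, h => port_inj_mid s i u w hu hw h
  | leaf s i j, u, w, hu, hw, _ => port_inj_leaf s i j u w hu hw

theorem le_ncard (v : BroomNode k δ N) (d : ℕ)
    (h : ∀ p < d, ∃ u, (graph k δ N).Adj v u ∧ port v u = p) :
    d ≤ ((graph k δ N).neighborSet v).ncard := by
  have h1 : Set.Iio d ⊆ port v '' (graph k δ N).neighborSet v := by
    intro p hp
    obtain ⟨u, hu, hp⟩ := h p hp
    exact ⟨u, hu, hp⟩
  have h2 := Set.ncard_le_ncard h1 (Set.toFinite _)
  have h3 := Set.ncard_image_le (f := port v) (Set.toFinite ((graph k δ N).neighborSet v))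
  have h4 : (Set.Iio d).ncard = d := by
    rw [← Finset.coe_Iio, Set.ncard_coe_finset, Nat.card_Iio]
  omega

theorem exists_handle_port (j : Fin (2 * k + 2)) (p : ℕ) (hp : p < 2)
    (hj : p = 0 ∨ (0 < (j : ℕ) ∧ (j : ℕ) < 2 * k + 1)) :
    ∃ u : BroomNode k δ N, (graph k δ N).Adj (handle j) u ∧
      port (handle j : BroomNode k δ N) u = p := by
  obtain ⟨j, hj'⟩ := j
  simp only at hj
  by_cases h : j % 2 = p
  · refine ⟨handle ⟨j + 1, by omega⟩, by simp [graph, IsParent], ?_⟩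
    simp only [port]
    omega
  · refine ⟨handle ⟨j - 1, by omega⟩, ?_, ?_⟩
    · simp only [graph, IsParent]
      omega
    · simp only [port]
      omega

theorem exists_end_port (s : Bool) (p : ℕ) (hp : p < δ + 2) :
    ∃ u : BroomNode k δ N, (graph k δ N).Adj (handle (handleEnd k s)) u ∧
      port (handle (handleEnd k s) : BroomNode k δ N) u = p := by
  rcases p with _ | p
  · exact exists_handle_port _ 0 (by omega) (Or.inl rfl)
  · exact ⟨mid s ⟨p, by omega⟩, by simp [graph, IsParent], rfl⟩

theorem port_lt (v u : BroomNode k δ N) (hu : (graph k δ N).Adj v u) :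
    port v u < ((graph k δ N).neighborSet v).ncard := by
  rcases v with j | ⟨s, i⟩ | ⟨s, i, j⟩
  · by_cases h : ∃ s, j = handleEnd k s
    · obtain ⟨s, rfl⟩ := h
      refine lt_of_lt_of_le ?_ (le_ncard _ (δ + 2) fun p hp => exists_end_port s p hp)
      rcases u with j1 | ⟨s1, i1, hi1⟩ | ⟨s1, i1, l1⟩ <;> simp only [port] <;> omega
    · have hj : 0 < (j : ℕ) ∧ (j : ℕ) < 2 * k + 1 := by
        constructor
        · by_contra h0
          exact h ⟨false, Fin.ext (show (j : ℕ) = 0 by omega)⟩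
        · by_contra h0
          exact h ⟨true, Fin.ext (show (j : ℕ) = 2 * k + 1 by omega)⟩
      refine lt_of_lt_of_le ?_ (le_ncard _ 2 fun p hp => exists_handle_port j p hp (Or.inr hj))
      rcases u with j1 | ⟨s1, i1, hi1⟩ | ⟨s1, i1, l1⟩
      · simp only [port]
        omega
      · exact absurd ⟨s1, by simpa [graph, IsParent] using hu⟩ h
      · simp [port]
  · refine lt_of_lt_of_le ?_ (le_ncard _ (N s i + 1) fun p hp => ?_)
    · rcases u with j1 | ⟨s1, i1⟩ | ⟨s1, i1, l1, hl1⟩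
      · simp [port]
      · simp [port]
      · simp only [graph, IsParent, false_or] at hu
        obtain ⟨rfl, rfl⟩ := hu
        simp only [port]
        omega
    · rcases p with _ | p
      · exact ⟨handle (handleEnd k s), by simp [graph, IsParent], rfl⟩
      · exact ⟨leaf s i ⟨p, by omega⟩, by simp [graph, IsParent], rfl⟩
  · refine lt_of_lt_of_le ?_ (le_ncard _ 1 fun p hp => ?_)
    · simp [port]
    · obtain rfl : p = 0 := by omega
      exact ⟨mid s i, by simp [graph, IsParent], rfl⟩

end BroomNode

/-- The double broom with handle length `2 * k + 1` in which the node `mid s i` has `N s i`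
leaves attached. -/
def broom (k δ : ℕ) (N : Bool → Fin (δ + 1) → ℕ) : PortTree where
  V := BroomNode k δ N
  finite := inferInstance
  graph := BroomNode.graph k δ N
  isTree := BroomNode.graph_isTree k δ N
  port := BroomNode.port
  port_lt := BroomNode.port_lt
  port_inj := BroomNode.port_inj

/-- The numbers of leaves attached on one side of a double broom: `x 1, …, x δ`, and as
`(δ + 1)`-st entry `δ ^ 2 - (x 1 + … + x δ)`, so that the total is `δ ^ 2`.  All entries of `x`
are at most `δ` below, so that the subtraction is the genuine one. -/
def leafCounts {δ : ℕ} (x : Fin δ → ℕ) : Fin (δ + 1) → ℕ :=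
  Fin.snoc (α := fun _ => ℕ) x (δ ^ 2 - ∑ i, x i)

/-- The double broom `DB_δ(a, b)` of diameter `2 * k + 5`, where `f` is a bijection from the
parameters `1, …, δ ^ δ` (here shifted to `0, …, δ ^ δ - 1`) to the `δ`-tuples with entries in
`{1, …, δ}` (entries here shifted to `0, …, δ - 1`, hence the `+ 1`).  Side `false` of the double
broom belongs to `a` and side `true` to `b`. -/
def doubleBroom (k δ : ℕ) (f : Fin (δ ^ δ) ≃ (Fin δ → Fin δ)) (a b : Fin (δ ^ δ)) : PortTree :=
  broom k δ fun s => leafCounts fun i => (f (if s then b else a) i : ℕ) + 1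

/-- The class of all double brooms `DB_δ(a, b)` with `a < b` and (odd) diameter `D ≥ 5`. -/
def doubleBroomClass (D δ : ℕ) (f : Fin (δ ^ δ) ≃ (Fin δ → Fin δ)) : Set PortTree :=
  {T | ∃ k a b, D = 2 * k + 5 ∧ a < b ∧ T = doubleBroom k δ f a b}

/-! Let `D = 2 * k + 5`. In a double broom a leaf is at distance `2 * k + 4 = D - 1` from the
nearest node `mid` of the other side. In time `D - 2` it sees the far end of the handle, whose
degree and ports are the same in all brooms. Since the handle has odd length, its port sequence is a
palindrome, so the leaf cannot even tell at which end it sits: its view depends only on the leaf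
counts of its own side (`BroomNode.sameView_leaf`).

Suppose two brooms share a side `c` and get the same advice, and in the first one the leader is in
the half of `c`. The path from a leaf of `c` to that leader never crosses the middle edge of the
handle, so the same ports, output by the same leaf in the second broom, lead again into the half of
`c` (`BroomNode.half_leader_eq`). Hence, for a fixed advice string, the parameters split into those
that win the leader and those that lose it. Regard the broom of `a < b` as an edge of the complete
graph on `δ ^ δ` nodes, labelled by its advice: every label class is bipartite, so `q` labels
require `δ ^ δ ≤ 2 ^ q` (`card_le_two_pow_of_colouring`). Thus `q ≥ δ`, and with `δ` about `√n` some
string has length of order `log n`.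

With a map, time `D - 2` suffices because every node can reach an end of the handle through known
ports and read the leaf counts there, which differ between the two sides
(`BroomNode.code_eq_of_sameView`).

For `D = 3` the class consists of double stars that differ only in the port `t` of the central edge.
A leaf on the side without the leader must output `t` after one round, yet it sees only its own port
at the centre and the degree of the centre. So one string serves at most one `t` per side of the
leader (`StarNode.port_eq_of_leaders`). -/

namespace PortTree

/-! ### Traces as invariants of views -/

/-- `T.Trace x L y`: there is a walk from `x` to `y` along which the pairs (outgoing port,
incoming port) are listed, last one first, in `L`. -/
inductive Trace (T : PortTree) (x : T.V) : List (ℕ × ℕ) → T.V → Prop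
  | nil : Trace T x [] x
  | cons {L y z} : Trace T x L y → T.graph.Adj y z →
      Trace T x ((T.port y z, T.port z y) :: L) z

theorem Trace.dist_le {T : PortTree} {x y : T.V} {L : List (ℕ × ℕ)} (h : T.Trace x L y) :
    T.graph.dist x y ≤ L.length := by
  induction h with
  | nil => simp
  | @cons L y z _ hyz ih =>
    have h1 := T.isTree.connected.dist_triangle (u := x) (v := y) (w := z)
    have h2 : T.graph.dist y z = 1 := SimpleGraph.dist_eq_one_iff_adj.2 hyz
    simp only [List.length_cons]
    omega

/-- The outgoing ports alone fix the walk. The incoming ports are recorded as information by which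
nodes can be told apart. -/
theorem Trace.unique {T : PortTree} {x y z : T.V} {L : List (ℕ × ℕ)} (h : T.Trace x L y)
    (h' : T.Trace x L z) : y = z := by
  induction h generalizing z with
  | nil => cases h'; rfl
  | @cons L y w _ hyw ih =>
    generalize hL : (T.port y w, T.port w y) :: L = L' at h'
    cases h' with
    | nil => cases hL
    | @cons M u v hu huv =>
      simp only [List.cons.injEq, Prod.mk.injEq] at hL
      obtain ⟨⟨h1, _⟩, rfl⟩ := hL
      obtain rfl := ih hu
      exact T.port_inj _ _ _ hyw huv h1

/-- The last step of a trace is determined by its outgoing port. -/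
theorem Trace.step {T : PortTree} {x y z u : T.V} {L : List (ℕ × ℕ)} {p q : ℕ}
    (h : T.Trace x ((p, q) :: L) z) (hy : T.Trace x L y) (hu : T.graph.Adj y u)
    (hp : T.port y u = p) : z = u ∧ T.port u y = q := by
  generalize hL : (p, q) :: L = L' at h
  cases h with
  | nil => cases hL
  | @cons M v w hv hvw =>
    simp only [List.cons.injEq, Prod.mk.injEq] at hL
    obtain ⟨⟨h1, h2⟩, rfl⟩ := hL
    obtain rfl := hy.unique hv
    obtain rfl := T.port_inj _ _ _ hvw hu (h1.symm.trans hp.symm)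
    exact ⟨rfl, h2.symm⟩

theorem Trace.tail {T : PortTree} {x z : T.V} {L : List (ℕ × ℕ)} {e : ℕ × ℕ}
    (h : T.Trace x (e :: L) z) : ∃ y, T.Trace x L y := by
  cases h with
  | cons h _ => exact ⟨_, h⟩

theorem SameView.symm {r : ℕ} {T T' : PortTree} {x : T.V} {x' : T'.V}
    (h : SameView r T x T' x') : SameView r T' x' T x :=
  (viewSetoid r).iseqv.symm (x := ⟨T, x⟩) (y := ⟨T', x'⟩) h

/-- Equal views have the same short traces, ending in nodes of the same degree. -/
theorem SameView.trace {r : ℕ} {T T' : PortTree} {x y : T.V} {x' : T'.V}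
    (h : SameView r T x T' x') {L : List (ℕ × ℕ)} (hL : L.length ≤ r) (hy : T.Trace x L y) :
    ∃ y', T'.Trace x' L y' ∧ T'.degree y' = T.degree y := by
  obtain ⟨φ, h0, h1, h2, h3⟩ := h
  suffices H : ∃ hd : T.graph.dist x y ≤ r, T'.Trace x' L (φ ⟨y, hd⟩).1 by
    obtain ⟨hd, H⟩ := H
    exact ⟨_, H, (h3 ⟨y, hd⟩).symm⟩
  induction hy with
  | nil =>
    refine ⟨by simp, ?_⟩
    have : φ ⟨x, by simp⟩ = T'.ballRoot x' r := h0
    rw [this]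
    exact Trace.nil
  | @cons L y z hy hyz ih =>
    have hz := (Trace.cons hy hyz).dist_le
    obtain ⟨hd, ih⟩ := ih (by simp only [List.length_cons] at hL; omega)
    refine ⟨hz.trans hL, ?_⟩
    have hyz' := (h1 ⟨y, hd⟩ ⟨z, hz.trans hL⟩).1 hyz
    have e1 := h2 ⟨y, hd⟩ ⟨z, hz.trans hL⟩ hyz
    have e2 := h2 ⟨z, hz.trans hL⟩ ⟨y, hd⟩ hyz.symm
    simp only at e1 e2
    rw [e1, e2]
    exact Trace.cons ih hyz'

theorem exists_adj_dist_le (T : PortTree) {x y : T.V} {m : ℕ} (h : T.graph.dist x y ≤ m + 1) :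
    y = x ∨ ∃ z, T.graph.Adj z y ∧ T.graph.dist x z ≤ m := by
  obtain ⟨p, hp⟩ := (T.isTree.connected y x).exists_walk_length_eq_dist
  rw [SimpleGraph.dist_comm] at hp
  cases p with
  | nil => exact Or.inl rfl
  | @cons _ z _ hz q =>
    refine Or.inr ⟨z, hz.symm, ?_⟩
    have := SimpleGraph.dist_le q
    rw [SimpleGraph.dist_comm]
    simp only [SimpleGraph.Walk.length_cons] at hp
    omega

/-- Every node of a ball is joined to the centre by a geodesic inside the ball, so it is enough to
control the edges inside it; elsewhere `g` may be arbitrary. -/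
theorem dist_map_le {r : ℕ} {T T' : PortTree} {x : T.V} (g : T.V → T'.V)
    (hadj : ∀ y z, T.graph.dist x y ≤ r → T.graph.dist x z ≤ r →
      T.graph.Adj y z → T'.graph.Adj (g y) (g z)) {y : T.V} (hy : T.graph.dist x y ≤ r) :
    T'.graph.dist (g x) (g y) ≤ r := by
  suffices H : ∀ m ≤ r, ∀ y, T.graph.dist x y ≤ m → T'.graph.dist (g x) (g y) ≤ m from
    H r le_rfl y hy
  intro m
  induction m with
  | zero =>
    intro _ y hy
    rw [Nat.le_zero, T.isTree.connected.dist_eq_zero_iff] at hy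
    simp [hy]
  | succ m ih =>
    intro hm y hy
    rcases T.exists_adj_dist_le hy with rfl | ⟨z, hzy, hz⟩
    · simp
    · have h1 := ih (by omega) z hz
      have h2 := hadj z y (by omega) (by omega) hzy
      have h3 := T'.isTree.connected.dist_triangle (u := g x) (v := g z) (w := g y)
      have h4 := SimpleGraph.dist_eq_one_iff_adj.2 h2
      omega

/-- Views agree if there are maps between the trees that are mutually inverse on the balls and
preserve adjacency, ports and degrees there. -/
theorem sameView_of_maps {r : ℕ} {T T' : PortTree} {x : T.V} {x' : T'.V} (g : T.V → T'.V)
    (g' : T'.V → T.V) (hx : g x = x') (hx' : g' x' = x)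
    (hinv : ∀ y, T.graph.dist x y ≤ r → g' (g y) = y)
    (hinv' : ∀ y, T'.graph.dist x' y ≤ r → g (g' y) = y)
    (hadj : ∀ y z, T.graph.dist x y ≤ r → T.graph.dist x z ≤ r → T.graph.Adj y z →
      T'.graph.Adj (g y) (g z) ∧ T.port y z = T'.port (g y) (g z))
    (hadj' : ∀ y z, T'.graph.dist x' y ≤ r → T'.graph.dist x' z ≤ r → T'.graph.Adj y z →
      T.graph.Adj (g' y) (g' z))
    (hdeg : ∀ y, T.graph.dist x y ≤ r → T.degree y = T'.degree (g y)) :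
    SameView r T x T' x' := by
  subst hx
  have hd : ∀ y, T.graph.dist x y ≤ r → T'.graph.dist (g x) (g y) ≤ r := fun y hy =>
    dist_map_le g (fun y z h1 h2 h3 => (hadj y z h1 h2 h3).1) hy
  have hd' : ∀ y, T'.graph.dist (g x) y ≤ r → T.graph.dist x (g' y) ≤ r := fun y hy => by
    have := dist_map_le g' hadj' hy
    rwa [hx'] at this
  refine ⟨⟨fun y => ⟨g y.1, hd _ y.2⟩, fun y => ⟨g' y.1, hd' _ y.2⟩,
    fun y => Subtype.ext (hinv _ y.2), fun y => Subtype.ext (hinv' _ y.2)⟩, rfl,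
    fun y z => ⟨fun h => (hadj _ _ y.2 z.2 h).1, fun h => ?_⟩,
    fun y z h => (hadj _ _ y.2 z.2 h).2, fun y => hdeg _ y.2⟩
  have := hadj' _ _ (hd _ y.2) (hd _ z.2) h
  rwa [hinv _ y.2, hinv _ z.2] at this

/-! ### Outputs, election with a map, and transport of walks -/

theorem view_eq_of_sameView {r : ℕ} {T T' : PortTree} {x : T.V} {x' : T'.V}
    (h : SameView r T x T' x') : T.view x r = T'.view x' r :=
  Quotient.sound h

/-- The end of a walk is determined by its start and its outgoing ports. -/
theorem eq_of_outPorts_eq (T : PortTree) {x y z : T.V} (p : T.graph.Walk x y)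
    (q : T.graph.Walk x z) (h : T.outPorts p = T.outPorts q) : y = z := by
  induction p with
  | nil =>
    cases q with
    | nil => rfl
    | cons _ _ => simp [outPorts] at h
  | @cons x u y hu p ih =>
    cases q with
    | nil => simp [outPorts] at h
    | @cons _ v _ hv q =>
      simp only [outPorts, SimpleGraph.Walk.darts_cons, List.map_cons, List.cons.injEq] at h
      obtain rfl := T.port_inj _ _ _ hu hv h.1
      exact ih q h.2

theorem LeadsTo.unique {T : PortTree} {x y z : T.V} {P : List ℕ} (h : T.LeadsTo x P y)
    (h' : T.LeadsTo x P z) : y = z := by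
  obtain ⟨p, _, hp⟩ := h
  obtain ⟨q, _, hq⟩ := h'
  exact T.eq_of_outPorts_eq p q (hp.trans hq.symm)

/-- A node with the same views up to time `τ` in two trees gives the same output in both. -/
theorem Algorithm.HaltsWith.output_eq {A : Algorithm} {s : List Bool} {T T' : PortTree} {x : T.V}
    {x' : T'.V} {τ r r' : ℕ} {P P' : List ℕ} (h : A.HaltsWith s T x r P)
    (h' : A.HaltsWith s T' x' r' P') (hr : r ≤ τ) (hr' : r' ≤ τ)
    (hv : ∀ t ≤ τ, SameView t T x T' x') : P = P' := by
  -- Halting in different rounds is impossible: in the earlier of the two rounds the common view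
  -- would yield both an output and `none`.
  rcases lt_trichotomy r r' with hlt | rfl | hlt
  · have := h'.2 r hlt
    rw [← view_eq_of_sameView (hv r hr), h.1] at this
    cases this
  · have := h'.1
    rw [← view_eq_of_sameView (hv r hr), h.1] at this
    exact Option.some.inj this
  · have := h.2 r' hlt
    rw [view_eq_of_sameView (hv r' hr'), h'.1] at this
    cases this

open Classical in
/-- Leader election with a map is feasible in time `τ` if the view at time `τ` determines a
sequence of ports leading to a fixed node. -/
theorem xi_le (T : PortTree) (τ : ℕ) (leader : T.V) (code : T.V → List ℕ)
    (hlead : ∀ x, T.LeadsTo x (code x) leader)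
    (hcode : ∀ x y, SameView τ T x T y → code x = code y) : T.xi ≤ (τ : ℕ∞) := by
  let A : Algorithm := fun _ r v =>
    if r = τ then
      if h : ∃ x, T.view x r = v then some (code h.choose) else none
    else none
  refine iInf₂_le τ ⟨A, leader, fun x => ⟨τ, le_rfl, code x, ⟨?_, ?_⟩, hlead x⟩⟩
  · have h : ∃ y, T.view y τ = T.view x τ := ⟨x, rfl⟩
    have h2 : SameView τ T h.choose T x := Quotient.exact h.choose_spec
    simp only [A, if_true, dif_pos h, hcode _ _ h2]
  · intro r hr
    simp [A, hr.ne]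

/-- A map that preserves adjacency and ports on a set transports walks inside that set. -/
theorem exists_walk_map {T T' : PortTree} (g : T.V → T'.V) (S : Set T.V)
    (hg : ∀ y z, y ∈ S → z ∈ S → T.graph.Adj y z →
      T'.graph.Adj (g y) (g z) ∧ T.port y z = T'.port (g y) (g z))
    {x y : T.V} (p : T.graph.Walk x y) (hp : ∀ v ∈ p.support, v ∈ S) :
    ∃ q : T'.graph.Walk (g x) (g y), T'.outPorts q = T.outPorts p := by
  induction p with
  | nil => exact ⟨SimpleGraph.Walk.nil, rfl⟩
  | @cons x u y hu p ih =>
    obtain ⟨q, hq⟩ := ih fun v hv => hp v (by simp [hv])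
    obtain ⟨h1, h2⟩ := hg x u (hp x (by simp)) (hp u (by simp)) hu
    refine ⟨SimpleGraph.Walk.cons h1 q, ?_⟩
    simp only [outPorts, SimpleGraph.Walk.darts_cons, List.map_cons] at hq ⊢
    rw [hq, h2]

theorem exists_walk_cons {T : PortTree} {x y z : T.V} {m : ℕ} {L : List ℕ}
    (h : T.graph.Adj x y) (hp : ∃ p : T.graph.Walk y z, p.length = m ∧ T.outPorts p = L) :
    ∃ p : T.graph.Walk x z, p.length = m + 1 ∧ T.outPorts p = T.port x y :: L := by
  obtain ⟨p, rfl, rfl⟩ := hp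
  exact ⟨SimpleGraph.Walk.cons h p, rfl, rfl⟩

theorem degree_eq_of_ports (T : PortTree) (v : T.V) (d : ℕ)
    (h : ∀ p < d, ∃ u, T.graph.Adj v u ∧ T.port v u = p)
    (h' : ∀ u, T.graph.Adj v u → T.port v u < d) : T.degree v = d := by
  have h1 : T.port v '' T.graph.neighborSet v = Set.Iio d := by
    ext p
    constructor
    · rintro ⟨u, hu, rfl⟩
      exact h' u hu
    · intro hp
      obtain ⟨u, hu, hp⟩ := h p hp
      exact ⟨u, hu, hp⟩
  have h2 := Set.InjOn.ncard_image (s := T.graph.neighborSet v) (f := T.port v)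
    fun u hu w hw h => T.port_inj v u w hu hw h
  rw [h1, ← Finset.coe_Iio, Set.ncard_coe_finset, Nat.card_Iio] at h2
  exact h2.symm

theorem diam_eq_of_dist (T : PortTree) (d : ℕ) (h : ∀ u v, T.graph.dist u v ≤ d) (u v : T.V)
    (huv : d ≤ T.graph.dist u v) : T.diam = d := by
  have : Nonempty T.V := ⟨u⟩
  apply le_antisymm
  · obtain ⟨x, y, hxy⟩ := T.graph.exists_dist_eq_diam
    exact hxy.symm.le.trans (h x y)
  · exact huv.trans
      (SimpleGraph.dist_le_diam (SimpleGraph.connected_iff_ediam_ne_top.1 T.isTree.connected))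

end PortTree

/-! ### Paths confined to a set, distance bounds, and counting -/

/-- A path whose ends lie in a set all of whose outgoing edges start at the same node stays in
that set. -/
theorem SimpleGraph.Walk.IsPath.mem_of_boundary {V : Type*} {G : SimpleGraph V} {x y : V}
    {p : G.Walk x y} (hp : p.IsPath) (S : Set V) (e : V)
    (hS : ∀ u v, G.Adj u v → u ∈ S → v ∉ S → u = e) (hx : x ∈ S) (hy : y ∈ S) {z : V}
    (hz : z ∈ p.support) : z ∈ S := by
  classical
  by_contra hzS
  -- If the path visited `z` outside `S`, it would leave `S` through `e` before `z` and, read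
  -- backwards from `y`, again through `e` after `z`. So `e` would occur twice on a path.
  obtain ⟨d, hd, hd1, hd2⟩ := (p.takeUntil z hz).exists_boundary_dart S hx hzS
  obtain ⟨c, hc, hc1, hc2⟩ := (p.dropUntil z hz).reverse.exists_boundary_dart S hy hzS
  have h1 : d.fst = e := hS _ _ d.adj hd1 hd2
  have h2 : c.fst = e := hS _ _ c.adj hc1 hc2
  have h3 : e ∈ (p.takeUntil z hz).support := h1 ▸
    SimpleGraph.Walk.dart_fst_mem_support_of_mem_darts _ hd
  have h4 : e ∈ (p.dropUntil z hz).support := by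
    have := SimpleGraph.Walk.dart_fst_mem_support_of_mem_darts _ hc
    rw [SimpleGraph.Walk.support_reverse, List.mem_reverse] at this
    exact h2 ▸ this
  have hez : e ≠ z := by
    rintro rfl
    exact hzS (h1 ▸ hd1)
  have h5 := hp.support_nodup
  rw [← p.take_spec hz, SimpleGraph.Walk.support_append] at h5
  have h6 : e ∈ (p.dropUntil z hz).support.tail := by
    rw [← SimpleGraph.Walk.cons_tail_support] at h4
    exact (List.mem_cons.1 h4).resolve_left hez
  exact (List.nodup_append.1 h5).2.2 e h3 e h6 rfl

/-- A function on nodes that changes by at most one along edges bounds distances. -/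
theorem SimpleGraph.Connected.le_add_dist {V : Type*} {G : SimpleGraph V} (hG : G.Connected)
    (h : V → ℕ) (hh : ∀ u v, G.Adj u v → h v ≤ h u + 1) (u v : V) : h v ≤ h u + G.dist u v := by
  obtain ⟨p, hp⟩ := (hG u v).exists_walk_length_eq_dist
  rw [← hp]
  clear hp
  induction p with
  | nil => simp
  | @cons a b c hab p ih =>
    have := hh a b hab
    simp only [SimpleGraph.Walk.length_cons]
    omega

/-- There are `2 ^ m - 1` such strings; the final counts need the inequality to be strict. -/
theorem exists_strings_of_length_lt (m : ℕ) :
    ∃ S : Finset (List Bool), (∀ l : List Bool, l.length < m → l ∈ S) ∧ S.card < 2 ^ m := by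
  induction m with
  | zero => exact ⟨∅, by simp⟩
  | succ m ih =>
    obtain ⟨S, h1, h2⟩ := ih
    classical
    let U : Finset (List Bool) := Finset.univ.image (fun v : List.Vector Bool m => v.toList)
    refine ⟨S ∪ U, fun l hl => ?_, ?_⟩
    · rcases Nat.lt_succ_iff_lt_or_eq.1 hl with h | h
      · exact Finset.mem_union_left _ (h1 l h)
      · exact Finset.mem_union_right _ (Finset.mem_image.2 ⟨⟨l, h⟩, Finset.mem_univ _, rfl⟩)
    · have h3 := Finset.card_union_le S U
      have h4 : U.card ≤ 2 ^ m := Finset.card_image_le.trans (by simp)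
      rw [pow_succ]
      omega

/-- If the edges of a complete graph are labelled in such a way that the edges with a given label
form a bipartite graph, then the number of nodes is at most exponential in the number of
labels. -/
theorem card_le_two_pow_of_colouring {α σ : Type*} [Fintype α] [LinearOrder α] (S : Finset σ)
    (w : α → α → σ) (colour : σ → α → Prop)
    (h : ∀ a b, a < b → w a b ∈ S ∧ ¬(colour (w a b) a ↔ colour (w a b) b)) :
    Fintype.card α ≤ 2 ^ S.card := by
  classical
  rw [← Finset.card_powerset, ← Finset.card_univ]
  -- A node is sent to the set of labels for which it is coloured. The sets of two nodes differ at
  -- the label of the edge joining them.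
  refine Finset.card_le_card_of_injOn (fun a => S.filter fun s => colour s a)
    (fun a _ => Finset.mem_coe.2 (Finset.mem_powerset.2 (Finset.filter_subset _ _)))
    fun a _ b _ hab => ?_
  by_contra hne
  have key : ∀ a b, a < b → (S.filter fun s => colour s a) ≠ S.filter fun s => colour s b := by
    intro a b hlt he
    obtain ⟨h1, h2⟩ := h a b hlt
    have := Finset.ext_iff.1 he (w a b)
    simp only [Finset.mem_filter, h1, true_and] at this
    exact h2 this
  rcases lt_or_gt_of_ne hne with hlt | hlt
  · exact key a b hlt hab
  · exact key b a hlt hab.symm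

/-! ### Degrees, distances and routes in a double broom -/

namespace BroomNode

variable {k δ : ℕ} {N N' : Bool → Fin (δ + 1) → ℕ}

theorem val_handleEnd (s : Bool) : (handleEnd k s : ℕ) = if s then 2 * k + 1 else 0 := by
  cases s <;> rfl

theorem isParent_cases {u v : BroomNode k δ N} (h : IsParent u v) :
    (∃ j j' : Fin (2 * k + 2), u = handle j ∧ v = handle j' ∧ (j : ℕ) = j' + 1) ∨
      (∃ s i, u = mid s i ∧ v = handle (handleEnd k s)) ∨
      ∃ s i j, u = leaf s i j ∧ v = mid s i := by
  rcases u with j | ⟨s, i⟩ | ⟨s, i, j⟩ <;> rcases v with j' | ⟨s', i'⟩ | ⟨s', i', j'⟩ <;>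
    try exact h.elim
  · exact Or.inl ⟨j, j', rfl, rfl, h⟩
  · obtain rfl : j' = handleEnd k s := h
    exact Or.inr (Or.inl ⟨s, i, rfl, rfl⟩)
  · obtain ⟨rfl, rfl⟩ := h
    exact Or.inr (Or.inr ⟨s, i, j, rfl, rfl⟩)

theorem degree_handleEnd (s : Bool) :
    (broom k δ N).degree (handle (handleEnd k s) : BroomNode k δ N) = δ + 2 := by
  refine PortTree.degree_eq_of_ports _ _ _ (fun p hp => exists_end_port s p hp) ?_
  rintro (j | ⟨s1, i⟩ | ⟨s1, i, l⟩) hu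
  · change min _ _ % 2 < _
    omega
  · change (i : ℕ) + 1 < _
    omega
  · change 0 < _
    omega

theorem degree_handle (j : Fin (2 * k + 2)) (h0 : 0 < (j : ℕ)) (h1 : (j : ℕ) < 2 * k + 1) :
    (broom k δ N).degree (handle j : BroomNode k δ N) = 2 := by
  refine PortTree.degree_eq_of_ports _ _ _
    (fun p hp => exists_handle_port j p hp (Or.inr ⟨h0, h1⟩)) ?_
  rintro (j' | ⟨s1, i⟩ | ⟨s1, i, l⟩) hu
  · change min _ _ % 2 < _
    omega
  · have hu' : (graph k δ N).Adj (handle j) (mid s1 i) := hu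
    have hj : j = handleEnd k s1 := hu'.resolve_left id
    rw [hj, val_handleEnd] at h0 h1
    cases s1 <;> simp at h0 h1
  · change 0 < _
    omega

theorem degree_mid (s : Bool) (i : Fin (δ + 1)) :
    (broom k δ N).degree (mid s i : BroomNode k δ N) = N s i + 1 := by
  refine PortTree.degree_eq_of_ports _ _ _ (fun p hp => ?_) ?_
  · rcases p with _ | p
    · exact ⟨(handle (handleEnd k s) : BroomNode k δ N), Or.inl rfl, rfl⟩
    · exact ⟨(leaf s i ⟨p, by omega⟩ : BroomNode k δ N), Or.inr ⟨rfl, rfl⟩, rfl⟩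
  · rintro (j' | ⟨s1, i1⟩ | ⟨s1, i1, l⟩) hu
    · exact Nat.succ_pos _
    · exact Nat.succ_pos _
    · have hu' : (graph k δ N).Adj (mid s i) (leaf s1 i1 l) := hu
      simp only [graph, IsParent, false_or] at hu'
      obtain ⟨rfl, rfl⟩ := hu'
      exact Nat.succ_lt_succ l.2

theorem degree_leaf (s : Bool) (i : Fin (δ + 1)) (j : Fin (N s i)) :
    (broom k δ N).degree (leaf s i j : BroomNode k δ N) = 1 := by
  refine PortTree.degree_eq_of_ports _ _ _ (fun p hp => ?_) ?_
  · obtain rfl : p = 0 := by omega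
    exact ⟨(mid s i : BroomNode k δ N), Or.inl ⟨rfl, rfl⟩, rfl⟩
  · rintro (j' | ⟨s1, i1⟩ | ⟨s1, i1, l⟩) hu <;> exact Nat.one_pos

/-- The distance from the leaves on side `false`, up to a constant on side `false`. -/
def height : BroomNode k δ N → ℕ
  | handle j => j + 2
  | mid s _ => if s then 2 * k + 4 else 1
  | leaf s _ _ => if s then 2 * k + 5 else 0

theorem height_le_of_adj (u v : BroomNode k δ N) (h : (graph k δ N).Adj u v) :
    height v ≤ height u + 1 := by
  rcases h with h | h <;>
    rcases isParent_cases h with ⟨j, j', rfl, rfl, hj⟩ | ⟨s, i, rfl, rfl⟩ | ⟨s, i, j, rfl, rfl⟩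
  · simp only [height]
    omega
  · cases s <;> simp [height, val_handleEnd]
  · cases s <;> simp [height]
  · simp only [height]
    omega
  · cases s <;> simp [height, val_handleEnd]
  · cases s <;> simp [height]

theorem height_le_add_dist (u v : BroomNode k δ N) :
    height v ≤ height u + (graph k δ N).dist u v :=
  (graph_isTree k δ N).connected.le_add_dist height height_le_of_adj u v

/-- The distance from `handle 0`. -/
def rank : BroomNode k δ N → ℕ
  | handle j => j
  | mid s _ => if s then 2 * k + 2 else 1
  | leaf s _ _ => if s then 2 * k + 3 else 2

theorem rank_le_of_adj (u v : BroomNode k δ N) (h : (graph k δ N).Adj u v) :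
    rank v ≤ rank u + 1 := by
  rcases h with h | h <;>
    rcases isParent_cases h with ⟨j, j', rfl, rfl, hj⟩ | ⟨s, i, rfl, rfl⟩ | ⟨s, i, j, rfl, rfl⟩
  · simp only [rank]
    omega
  · cases s <;> simp [rank, val_handleEnd]
  · cases s <;> simp [rank]
  · simp only [rank]
    omega
  · cases s <;> simp [rank, val_handleEnd]
  · cases s <;> simp [rank]

theorem rank_le_dist (u : BroomNode k δ N) : rank u ≤ (graph k δ N).dist u (handle 0) := by
  have := (graph_isTree k δ N).connected.le_add_dist rank rank_le_of_adj (handle 0) u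
  rw [SimpleGraph.dist_comm]
  simpa [rank] using this

/-- The outgoing ports on the way from `handle j` to `handle 0`. -/
def handleCode : ℕ → List ℕ
  | 0 => []
  | j + 1 => (j % 2) :: handleCode j

/-- The outgoing ports on the way from a node to `handle 0`. -/
def code : BroomNode k δ N → List ℕ
  | handle j => handleCode j
  | mid s _ => 0 :: handleCode (handleEnd k s)
  | leaf s _ _ => 0 :: 0 :: handleCode (handleEnd k s)

theorem exists_walk_handle (j : ℕ) (hj : j < 2 * k + 2) :
    ∃ p : (broom k δ N).graph.Walk (handle ⟨j, hj⟩ : BroomNode k δ N)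
      (handle 0 : BroomNode k δ N),
      p.length = j ∧ (broom k δ N).outPorts p = handleCode j := by
  induction j with
  | zero => exact ⟨SimpleGraph.Walk.nil, rfl, rfl⟩
  | succ j ih =>
    have h : (graph k δ N).Adj (handle ⟨j + 1, hj⟩) (handle ⟨j, by omega⟩) := Or.inl rfl
    have := PortTree.exists_walk_cons (T := broom k δ N) h (ih (by omega))
    change ∃ p, _ ∧ _ = (min (j + 1) j % 2) :: _ at this
    rwa [min_eq_right (Nat.le_succ j)] at this

theorem exists_walk_code (x : BroomNode k δ N) :
    ∃ p : (broom k δ N).graph.Walk x (handle 0 : BroomNode k δ N),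
      p.length = rank x ∧ (broom k δ N).outPorts p = code x := by
  have hmid : ∀ s i, ∃ p : (broom k δ N).graph.Walk (mid s i : BroomNode k δ N)
      (handle 0 : BroomNode k δ N), p.length = rank (mid s i : BroomNode k δ N) ∧
        (broom k δ N).outPorts p = code (mid s i : BroomNode k δ N) := by
    intro s i
    have h : (graph k δ N).Adj (mid s i) (handle (handleEnd k s)) := Or.inl rfl
    have := PortTree.exists_walk_cons (T := broom k δ N) h
      (exists_walk_handle (handleEnd k s) (handleEnd k s).2)
    have hr : rank (mid s i : BroomNode k δ N) = handleEnd k s + 1 := by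
      cases s <;> simp [rank, val_handleEnd]
    rw [hr]
    exact this
  rcases x with j | ⟨s, i⟩ | ⟨s, i, j⟩
  · exact exists_walk_handle j j.2
  · exact hmid s i
  · have h : (graph k δ N).Adj (leaf s i j) (mid s i) := Or.inl ⟨rfl, rfl⟩
    have := PortTree.exists_walk_cons (T := broom k δ N) h (hmid s i)
    have hr : rank (leaf s i j : BroomNode k δ N) = rank (mid s i : BroomNode k δ N) + 1 := by
      cases s <;> simp [rank]
    rw [hr]
    exact this

theorem leadsTo_code (x : BroomNode k δ N) :
    (broom k δ N).LeadsTo x (code x) (handle 0 : BroomNode k δ N) := by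
  obtain ⟨p, hp, hp'⟩ := exists_walk_code x
  -- A walk as short as the distance is a path, so its nodes need not be compared.
  exact ⟨p, p.isPath_of_length_eq_dist
    (le_antisymm (hp.le.trans (rank_le_dist x)) (SimpleGraph.dist_le p)), hp'⟩

/-- The node of the handle closest to a given node. -/
def foot : BroomNode k δ N → Fin (2 * k + 2)
  | handle j => j
  | mid s _ => handleEnd k s
  | leaf s _ _ => handleEnd k s

theorem dist_handle_le (a b : ℕ) (hb : a + b < 2 * k + 2) :
    (graph k δ N).dist (handle ⟨a, by omega⟩) (handle ⟨a + b, hb⟩) ≤ b := by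
  induction b with
  | zero => simp
  | succ b ih =>
    have h1 := ih (by omega)
    have h2 : (graph k δ N).dist (handle ⟨a + b, by omega⟩) (handle ⟨a + (b + 1), hb⟩) = 1 :=
      SimpleGraph.dist_eq_one_iff_adj.2 (Or.inr rfl)
    have h3 := (graph_isTree k δ N).connected.dist_triangle (u := handle ⟨a, by omega⟩)
      (v := handle ⟨a + b, by omega⟩) (w := handle ⟨a + (b + 1), hb⟩)
    omega

theorem dist_handle_handle_le (i j : Fin (2 * k + 2)) :
    (graph k δ N).dist (handle i) (handle j) ≤ 2 * k + 1 := by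
  have key : ∀ i j : Fin (2 * k + 2), (i : ℕ) ≤ j →
      (graph k δ N).dist (handle i) (handle j) ≤ 2 * k + 1 := by
    rintro ⟨i, hi⟩ ⟨j, hj⟩ hij
    obtain ⟨b, rfl⟩ := Nat.exists_eq_add_of_le hij
    exact (dist_handle_le i b hj).trans (by omega)
  rcases le_total (i : ℕ) j with h | h
  · exact key i j h
  · rw [SimpleGraph.dist_comm]
    exact key j i h

theorem dist_foot_le (x : BroomNode k δ N) : (graph k δ N).dist x (handle (foot x)) ≤ 2 := by
  have hmid : ∀ s i, (graph k δ N).dist (mid s i) (handle (handleEnd k s)) = 1 := fun s i =>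
    SimpleGraph.dist_eq_one_iff_adj.2 (Or.inl rfl)
  rcases x with j | ⟨s, i⟩ | ⟨s, i, j⟩
  · simp [foot]
  · exact (hmid s i).le.trans one_le_two
  · have h1 := hmid s i
    have h2 : (graph k δ N).dist (leaf s i j) (mid s i) = 1 :=
      SimpleGraph.dist_eq_one_iff_adj.2 (Or.inl ⟨rfl, rfl⟩)
    have h3 := (graph_isTree k δ N).connected.dist_triangle (u := leaf s i j)
      (v := mid s i) (w := handle (handleEnd k s))
    change (graph k δ N).dist (leaf s i j) (handle (handleEnd k s)) ≤ 2
    omega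

theorem diam_broom (hN : ∀ s, 0 < N s 0) : (broom k δ N).diam = 2 * k + 5 := by
  refine PortTree.diam_eq_of_dist _ _ ?_ (leaf false 0 ⟨0, hN _⟩ : BroomNode k δ N)
    (leaf true 0 ⟨0, hN _⟩ : BroomNode k δ N) ?_
  · intro (u : BroomNode k δ N) (v : BroomNode k δ N)
    change (graph k δ N).dist u v ≤ _
    have hc := (graph_isTree k δ N).connected
    have h1 := dist_foot_le u
    have h2 := dist_foot_le v
    rw [SimpleGraph.dist_comm] at h2
    have h3 := dist_handle_handle_le (N := N) (foot u) (foot v)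
    have h4 := hc.dist_triangle (u := u) (v := handle (foot u)) (w := handle (foot v))
    have h5 := hc.dist_triangle (u := u) (v := handle (foot v)) (w := v)
    omega
  · have := height_le_add_dist (leaf false 0 ⟨0, hN _⟩ : BroomNode k δ N)
      (leaf true 0 ⟨0, hN _⟩ : BroomNode k δ N)
    simp only [height, if_true, Bool.false_eq_true, if_false, zero_add] at this
    exact this

theorem size_broom :
    (broom k δ N).size = (2 * k + 2) + (2 * (δ + 1) + ∑ s, ∑ i, N s i) := by
  let e : BroomNode k δ N ≃ Fin (2 * k + 2) ⊕ (Bool × Fin (δ + 1)) ⊕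
      (Σ s : Bool, Σ i : Fin (δ + 1), Fin (N s i)) :=
    { toFun := fun x => match x with
        | handle j => .inl j
        | mid s i => .inr (.inl (s, i))
        | leaf s i j => .inr (.inr ⟨s, i, j⟩)
      invFun := fun t => match t with
        | .inl j => handle j
        | .inr (.inl p) => mid p.1 p.2
        | .inr (.inr q) => leaf q.1 q.2.1 q.2.2
      left_inv := by rintro (j | ⟨s, i⟩ | ⟨s, i, j⟩) <;> rfl
      right_inv := by rintro (j | ⟨s, i⟩ | ⟨s, i, j⟩) <;> rfl }
  change Nat.card (BroomNode k δ N) = _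
  rw [Nat.card_congr e, Nat.card_eq_fintype_card]
  simp only [Fintype.card_sum, Fintype.card_prod, Fintype.card_sigma, Fintype.card_fin,
    Fintype.card_bool]

/-! ### What a leaf can see in time `D - 2` -/

/-- The nodes of the handle and of side `s`. -/
def OnSide (s : Bool) : BroomNode k δ N → Prop
  | handle _ => True
  | mid t _ => t = s
  | leaf t _ _ => t = s

/-- The map between double brooms that takes the handle to the handle, reversing it if `s ≠ s'`,
and side `s` to side `s'`. -/
def move (N' : Bool → Fin (δ + 1) → ℕ) (s s' : Bool) : BroomNode k δ N → BroomNode k δ N'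
  | handle j => handle (if s = s' then j else j.rev)
  | mid _ i => mid s' i
  -- The value `handle 0` is a dummy: it does not occur on side `s` when `N s = N' s'`.
  | leaf _ i j => if h : (j : ℕ) < N' s' i then leaf s' i ⟨j, h⟩ else handle 0

theorem move_handleEnd (s s' : Bool) :
    move N' s s' (handle (handleEnd k s) : BroomNode k δ N) = handle (handleEnd k s') := by
  cases s <;> cases s' <;> simp [move, handleEnd]

theorem move_leaf {s s' : Bool} (h : N s = N' s') (i : Fin (δ + 1)) (j : Fin (N s i)) :
    move N' s s' (leaf s i j : BroomNode k δ N) = leaf s' i ⟨j, h ▸ j.2⟩ :=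
  dif_pos _

theorem move_move {s s' : Bool} (h : N s = N' s') (y : BroomNode k δ N) (hy : OnSide s y) :
    move N s' s (move N' s s' y) = y := by
  rcases y with j | ⟨t, i⟩ | ⟨t, i, j⟩
  · cases s <;> cases s' <;> simp [move]
  · obtain rfl : t = s := hy
    rfl
  · obtain rfl : t = s := hy
    rw [move_leaf h, move_leaf h.symm]

/-- Reversal takes the handle edge with lower end `j'` to the one with lower end `2 * k - j'`. The
two numbers have the same parity, so the ports survive; this is where the odd length of the handle
enters. Both ports are asserted so that one orientation of the edge suffices. -/
theorem move_isParent {s s' : Bool} (h : N s = N' s') (y z : BroomNode k δ N)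
    (hy : OnSide s y) (hz : OnSide s z) (hyz : IsParent y z) :
    (graph k δ N').Adj (move N' s s' y) (move N' s s' z) ∧
      port y z = port (move N' s s' y) (move N' s s' z) ∧
      port z y = port (move N' s s' z) (move N' s s' y) := by
  rcases y with ⟨j, hj⟩ | ⟨t, i⟩ | ⟨t, i, j⟩ <;> rcases z with ⟨j', hj'⟩ | ⟨t', i'⟩ | ⟨t', i', l⟩ <;>
    try exact hyz.elim
  · have hjj : j = j' + 1 := hyz
    subst hjj
    by_cases hss : s = s'
    · simp [move, graph, IsParent, port, hss]
    · simp only [move, graph, IsParent, port, hss, if_false, Fin.val_rev]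
      omega
  · obtain rfl : t = s := hy
    obtain rfl : j' = _ := congrArg Fin.val
      (show (⟨j', hj'⟩ : Fin (2 * k + 2)) = handleEnd k t from hyz)
    have := move_handleEnd (N := N) (N' := N') (k := k) t s'
    change (graph k δ N').Adj (mid s' i) (move N' t s' (handle (handleEnd k t))) ∧
      0 = port (mid s' i) (move N' t s' (handle (handleEnd k t))) ∧
      (i : ℕ) + 1 = port (move N' t s' (handle (handleEnd k t))) (mid s' i)
    rw [this]
    exact ⟨Or.inl rfl, rfl, rfl⟩
  · obtain rfl : t = s := hy
    obtain ⟨rfl, rfl⟩ := hyz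
    rw [move_leaf h]
    exact ⟨Or.inl ⟨rfl, rfl⟩, rfl, rfl⟩

theorem move_adj {s s' : Bool} (h : N s = N' s') (y z : BroomNode k δ N)
    (hy : OnSide s y) (hz : OnSide s z) (hyz : (graph k δ N).Adj y z) :
    (graph k δ N').Adj (move N' s s' y) (move N' s s' z) ∧
      port y z = port (move N' s s' y) (move N' s s' z) := by
  rcases hyz with hyz | hyz
  · have := move_isParent h y z hy hz hyz
    exact ⟨this.1, this.2.1⟩
  · have := move_isParent h z y hz hy hyz
    exact ⟨this.1.symm, this.2.2⟩

theorem eq_handleEnd_or (j : Fin (2 * k + 2)) :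
    (∃ s, j = handleEnd k s) ∨ 0 < (j : ℕ) ∧ (j : ℕ) < 2 * k + 1 := by
  by_cases h0 : (j : ℕ) = 0
  · exact Or.inl ⟨false, Fin.ext h0⟩
  · by_cases h1 : (j : ℕ) = 2 * k + 1
    · exact Or.inl ⟨true, Fin.ext h1⟩
    · omega

/-- Both ends of the handle have degree `δ + 2` whatever the leaf counts are. So the far end, which
a leaf sees at distance exactly `2 * k + 3`, reveals nothing. -/
theorem degree_move {s s' : Bool} (h : N s = N' s') (y : BroomNode k δ N) (hy : OnSide s y) :
    (broom k δ N).degree y = (broom k δ N').degree (move N' s s' y) := by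
  rcases y with j | ⟨t, i⟩ | ⟨t, i, j⟩
  · rcases eq_handleEnd_or j with ⟨t, rfl⟩ | hj
    · have : move N' s s' (handle (handleEnd k t) : BroomNode k δ N) =
          handle (handleEnd k (if s = s' then t else !t)) := by
        cases s <;> cases s' <;> cases t <;> simp [move, handleEnd]
      rw [this]
      exact (degree_handleEnd t).trans (degree_handleEnd _).symm
    · refine (degree_handle j hj.1 hj.2).trans (degree_handle _ ?_ ?_).symm <;>
        split_ifs <;> (try simp only [Fin.val_rev]) <;> omega
  · obtain rfl : t = s := hy
    refine (degree_mid t i).trans ?_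
    rw [h]
    exact (degree_mid s' i).symm
  · obtain rfl : t = s := hy
    rw [move_leaf h]
    exact (degree_leaf t i j).trans (degree_leaf s' i _).symm

/-- A leaf does not see the nodes on the other side within `2 * k + 3` rounds. -/
theorem onSide_of_dist_le {s : Bool} {i : Fin (δ + 1)} {j : Fin (N s i)} {y : BroomNode k δ N}
    (h : (graph k δ N).dist (leaf s i j) y ≤ 2 * k + 3) : OnSide s y := by
  -- Between a leaf and a `mid` or leaf of the other side, the heights differ by at least `2 * k +
  -- 4`.
  have h1 := height_le_add_dist (leaf s i j) y
  have h2 := height_le_add_dist y (leaf s i j)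
  rw [SimpleGraph.dist_comm] at h2
  rcases y with j' | ⟨t, i'⟩ | ⟨t, i', j'⟩ <;>
    try cases s <;> try cases t
  all_goals
    first
    | trivial
    | rfl
    | (simp [height] at h1 h2; omega)

/-- The view of a leaf within `2 * k + 3` rounds depends only on its own side. -/
theorem sameView_leaf {s s' : Bool} (h : N s = N' s') (i : Fin (δ + 1)) (j : Fin (N s i)) {r : ℕ}
    (hr : r ≤ 2 * k + 3) :
    PortTree.SameView r (broom k δ N) (leaf s i j : BroomNode k δ N) (broom k δ N')
      (leaf s' i ⟨j, h ▸ j.2⟩ : BroomNode k δ N') := by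
  have hs : ∀ y : BroomNode k δ N, (graph k δ N).dist (leaf s i j) y ≤ r → OnSide s y :=
    fun y hy => onSide_of_dist_le (hy.trans hr)
  have hs' : ∀ y : BroomNode k δ N',
      (graph k δ N').dist (leaf s' i ⟨j, h ▸ j.2⟩) y ≤ r → OnSide s' y :=
    fun y hy => onSide_of_dist_le (hy.trans hr)
  exact PortTree.sameView_of_maps (T := broom k δ N) (T' := broom k δ N') (move N' s s')
    (move N s' s) (move_leaf h i j) (move_leaf h.symm i _)
    (fun y hy => move_move h y (hs y hy)) (fun y hy => move_move h.symm y (hs' y hy))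
    (fun y z hy hz => move_adj h y z (hs y hy) (hs z hz))
    (fun y z hy hz hyz => (move_adj h.symm y z (hs' y hy) (hs' z hz) hyz).1)
    (fun y hy => degree_move h y (hs y hy))

end BroomNode

/-! ### With a map, time `D - 2` suffices -/

namespace BroomNode

variable {k δ : ℕ} {N N' : Bool → Fin (δ + 1) → ℕ}

/-- A trace of given ports in a double broom. -/
abbrev BTrace (x : BroomNode k δ N) (L : List (ℕ × ℕ)) (y : BroomNode k δ N) : Prop :=
  (broom k δ N).Trace x L y

theorem btrace_cons {x y z : BroomNode k δ N} {L : List (ℕ × ℕ)} (h : BTrace x L y)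
    (hyz : (graph k δ N).Adj y z) : BTrace x ((port y z, port z y) :: L) z :=
  PortTree.Trace.cons (T := broom k δ N) h hyz

theorem btrace_step {x y z u : BroomNode k δ N} {L : List (ℕ × ℕ)} {q : ℕ}
    (h : BTrace x ((port y u, q) :: L) z) (hy : BTrace x L y) (hu : (graph k δ N).Adj y u) :
    z = u ∧ port u y = q :=
  PortTree.Trace.step (T := broom k δ N) h hy hu rfl

theorem adj_mid (s : Bool) (i : Fin (δ + 1)) :
    (graph k δ N).Adj (mid s i) (handle (handleEnd k s)) := Or.inl rfl

theorem adj_leaf (s : Bool) (i : Fin (δ + 1)) (j : Fin (N s i)) :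
    (graph k δ N).Adj (leaf s i j) (mid s i) := Or.inl ⟨rfl, rfl⟩

/-- Nodes with the same view have the same traces, with ends of the same degree. -/
theorem exists_btrace {r : ℕ} {x x' y : BroomNode k δ N}
    (h : PortTree.SameView r (broom k δ N) x (broom k δ N) x') {L : List (ℕ × ℕ)}
    (hL : L.length ≤ r) (hy : BTrace x L y) :
    ∃ y' : BroomNode k δ N, BTrace x' L y' ∧
      (broom k δ N).degree y' = (broom k δ N).degree y :=
  PortTree.SameView.trace h hL hy

/-- The numbers of leaves on side `s` can be read off from traces through its endpoint. -/
theorem leaves_eq_of_btrace {r : ℕ} {x x' : BroomNode k δ N} {s s' : Bool}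
    (h : PortTree.SameView r (broom k δ N) x (broom k δ N) x') {L : List (ℕ × ℕ)}
    (hL : L.length < r) (hx : BTrace x L (handle (handleEnd k s)))
    (hx' : BTrace x' L (handle (handleEnd k s'))) : N s = N s' := by
  funext i
  -- One more step, through port `i + 1`, ends in `mid s i`, whose degree is `N s i + 1`. This step
  -- is the reason for the strict inequality `hL`.
  obtain ⟨y, hy, hd⟩ := exists_btrace h (by simpa using hL) (btrace_cons hx (adj_mid s i).symm)
  obtain ⟨rfl, -⟩ := btrace_step (u := mid s' i) hy hx' (adj_mid s' i).symm
  rw [degree_mid, degree_mid] at hd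
  omega

theorem btrace_mid (s : Bool) (i : Fin (δ + 1)) :
    BTrace (mid s i : BroomNode k δ N) [(0, i + 1)] (handle (handleEnd k s)) :=
  btrace_cons PortTree.Trace.nil (adj_mid s i)

theorem btrace_leaf (s : Bool) (i : Fin (δ + 1)) (j : Fin (N s i)) :
    BTrace (leaf s i j : BroomNode k δ N) [(0, i + 1), (0, j + 1)] (handle (handleEnd k s)) :=
  btrace_cons (btrace_cons PortTree.Trace.nil (adj_leaf s i j)) (adj_mid s i)

/-- Edges of the handle with even lower end have port `0` at both ends, and every handle node lies
on exactly one of them. The step `(0, 0)` sets the handle apart: port `0` of a `mid` or a leaf leads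
to a positive port. -/
theorem exists_btrace_handle (x : BroomNode k δ N) {L : List (ℕ × ℕ)} {j : Fin (2 * k + 2)}
    (h : BTrace x L (handle j)) : ∃ y, BTrace x ((0, 0) :: L) y := by
  obtain ⟨j, hj⟩ := j
  rcases Nat.even_or_odd' j with ⟨i, rfl | rfl⟩
  · have hadj : (graph k δ N).Adj (handle ⟨2 * i, hj⟩) (handle ⟨2 * i + 1, by omega⟩) :=
      Or.inr rfl
    have hp : 2 * i ⊓ (2 * i + 1) = 2 * i := by omega
    have hp' : (2 * i + 1) ⊓ (2 * i) = 2 * i := by omega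
    have := btrace_cons h hadj
    simp only [port, hp, hp', Nat.mul_mod_right] at this
    exact ⟨_, this⟩
  · have hadj : (graph k δ N).Adj (handle ⟨2 * i + 1, hj⟩) (handle ⟨2 * i, by omega⟩) :=
      Or.inl rfl
    have hp : 2 * i ⊓ (2 * i + 1) = 2 * i := by omega
    have hp' : (2 * i + 1) ⊓ (2 * i) = 2 * i := by omega
    have := btrace_cons h hadj
    simp only [port, hp, hp', Nat.mul_mod_right] at this
    exact ⟨_, this⟩

/-- The trace with ports `0,0,1,1,0,0,…` of a given length. -/
def altTrace : ℕ → List (ℕ × ℕ)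
  | 0 => []
  | m + 1 => (m % 2, m % 2) :: altTrace m

theorem length_altTrace (m : ℕ) : (altTrace m).length = m := by
  induction m with
  | zero => rfl
  | succ m ih => simp [altTrace, ih]

theorem btrace_even (i m : ℕ) (h : 2 * i + m < 2 * k + 2) :
    BTrace (handle ⟨2 * i, by omega⟩ : BroomNode k δ N) (altTrace m)
      (handle ⟨2 * i + m, h⟩) := by
  induction m with
  | zero => exact PortTree.Trace.nil
  | succ m ih =>
    have hadj : (graph k δ N).Adj (handle ⟨2 * i + m, by omega⟩) (handle ⟨2 * i + (m + 1), h⟩) :=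
      Or.inr rfl
    have hp : ((2 * i + m) ⊓ (2 * i + (m + 1))) % 2 = m % 2 := by omega
    have hp' : ((2 * i + (m + 1)) ⊓ (2 * i + m)) % 2 = m % 2 := by omega
    have := btrace_cons (ih (by omega)) hadj
    simp only [port, hp, hp'] at this
    exact this

theorem btrace_odd (i m : ℕ) (h : 2 * i + 1 < 2 * k + 2) (hm : m ≤ 2 * i + 1) :
    BTrace (handle ⟨2 * i + 1, h⟩ : BroomNode k δ N) (altTrace m)
      (handle ⟨2 * i + 1 - m, by omega⟩) := by
  induction m with
  | zero => exact PortTree.Trace.nil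
  | succ m ih =>
    have hadj : (graph k δ N).Adj (handle ⟨2 * i + 1 - m, by omega⟩)
        (handle ⟨2 * i + 1 - (m + 1), by omega⟩) := by
      refine Or.inl ?_
      change 2 * i + 1 - m = 2 * i + 1 - (m + 1) + 1
      omega
    have hp : ((2 * i + 1 - m) ⊓ (2 * i + 1 - (m + 1))) % 2 = m % 2 := by omega
    have hp' : ((2 * i + 1 - (m + 1)) ⊓ (2 * i + 1 - m)) % 2 = m % 2 := by omega
    have := btrace_cons (ih (by omega)) hadj
    simp only [port, hp, hp'] at this
    exact this

/-- Every node of the handle reaches one of its endpoints through ports `0,0,1,1,0,0,…`. -/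
theorem exists_btrace_alt (j : Fin (2 * k + 2)) :
    ∃ (s : Bool) (m : ℕ), 0 < m ∧ m ≤ 2 * k + 1 ∧ (j : ℕ) = (if s then 2 * k + 1 - m else m) ∧
      BTrace (handle j : BroomNode k δ N) (altTrace m) (handle (handleEnd k s)) ∧
      ∀ m', 0 < m' → m' < m → ∃ y : Fin (2 * k + 2), 0 < (y : ℕ) ∧ (y : ℕ) < 2 * k + 1 ∧
        BTrace (handle j : BroomNode k δ N) (altTrace m') (handle y) := by
  obtain ⟨j, hj⟩ := j
  -- Port `0` leads away from `handle 0` at even nodes and towards it at odd ones, so the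
  -- alternating walk ends on side `true` or `false` accordingly. Starting at an end of the handle,
  -- it runs to the opposite end; hence `0 < m`.
  rcases Nat.even_or_odd' j with ⟨i, rfl | rfl⟩
  · refine ⟨true, 2 * k + 1 - 2 * i, by omega, by omega, ?_, ?_, fun m' h0 h1 => ?_⟩
    · simp only [if_true]
      omega
    · have := btrace_even (N := N) i (2 * k + 1 - 2 * i) (by omega : _ < 2 * k + 2)
      have he : (⟨2 * i + (2 * k + 1 - 2 * i), by omega⟩ : Fin (2 * k + 2)) =
          handleEnd k true := Fin.ext (by simp only [val_handleEnd, if_true]; omega)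
      rwa [he] at this
    · exact ⟨⟨2 * i + m', by omega⟩, by simp only; omega, by simp only; omega,
        btrace_even i m' (by omega)⟩
  · refine ⟨false, 2 * i + 1, by omega, by omega, rfl, ?_, fun m' h0 h1 => ?_⟩
    · have := btrace_odd (N := N) i (2 * i + 1) hj le_rfl
      have he : (⟨2 * i + 1 - (2 * i + 1), by omega⟩ : Fin (2 * k + 2)) =
          handleEnd k false := Fin.ext (by simp [val_handleEnd])
      rwa [he] at this
    · exact ⟨⟨2 * i + 1 - m', by omega⟩, by simp only; omega, by simp only; omega,
        btrace_odd i m' hj (by omega)⟩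

/-- The alternating walk first meets degree `δ + 2`, which differs from `2`, after `m` steps, so the
view determines `m`. The leaf counts at the end reached tell which side it is, and side and `m`
together give the position. -/
theorem handle_eq_of_sameView (hδ : 0 < δ) (hN : ∀ s s', N s = N s' → s = s')
    {j j' : Fin (2 * k + 2)}
    (h : PortTree.SameView (2 * k + 3) (broom k δ N) (handle j : BroomNode k δ N)
      (broom k δ N) (handle j' : BroomNode k δ N)) : j = j' := by
  have key : ∀ {j j' : Fin (2 * k + 2)} {s : Bool} {m m' : ℕ},
      PortTree.SameView (2 * k + 3) (broom k δ N) (handle j : BroomNode k δ N)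
        (broom k δ N) (handle j' : BroomNode k δ N) → 0 < m → m ≤ 2 * k + 1 →
      BTrace (handle j : BroomNode k δ N) (altTrace m) (handle (handleEnd k s)) →
      (∀ n, 0 < n → n < m' → ∃ y : Fin (2 * k + 2), 0 < (y : ℕ) ∧ (y : ℕ) < 2 * k + 1 ∧
        BTrace (handle j' : BroomNode k δ N) (altTrace n) (handle y)) → ¬ m < m' := by
    intro j j' s m m' h h0 h1 h2 h3 hlt
    obtain ⟨y, hy0, hy1, hy⟩ := h3 m h0 hlt
    obtain ⟨z, hz, hd⟩ := exists_btrace h (by rw [length_altTrace]; omega) h2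
    obtain rfl : z = handle y := PortTree.Trace.unique hz hy
    rw [degree_handle y hy0 hy1, degree_handleEnd] at hd
    omega
  obtain ⟨s, m, h0, h1, hj, h2, h3⟩ := exists_btrace_alt (N := N) j
  obtain ⟨s', m', h0', h1', hj', h2', h3'⟩ := exists_btrace_alt (N := N) j'
  have a1 := key h h0 h1 h2 h3'
  have a2 := key h.symm h0' h1' h2' h3
  obtain rfl : m = m' := by omega
  obtain rfl := hN _ _ (leaves_eq_of_btrace h (by rw [length_altTrace]; omega) h2 h2')
  exact Fin.ext (hj.trans hj'.symm)

theorem not_sameView_handle_mid {r : ℕ} (hr : 1 ≤ r) {j : Fin (2 * k + 2)} {s : Bool}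
    {i : Fin (δ + 1)} (h : PortTree.SameView r (broom k δ N) (handle j : BroomNode k δ N)
      (broom k δ N) (mid s i : BroomNode k δ N)) : False := by
  obtain ⟨y, hy⟩ := exists_btrace_handle (handle j : BroomNode k δ N) PortTree.Trace.nil
  obtain ⟨z, hz, -⟩ := exists_btrace h (by simpa using hr) hy
  have := (btrace_step (y := mid s i) hz PortTree.Trace.nil (adj_mid s i)).2
  simp [port] at this

theorem not_sameView_handle_leaf {r : ℕ} (hr : 1 ≤ r) {j : Fin (2 * k + 2)} {s : Bool}
    {i : Fin (δ + 1)} {l : Fin (N s i)}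
    (h : PortTree.SameView r (broom k δ N) (handle j : BroomNode k δ N)
      (broom k δ N) (leaf s i l : BroomNode k δ N)) : False := by
  obtain ⟨y, hy⟩ := exists_btrace_handle (handle j : BroomNode k δ N) PortTree.Trace.nil
  obtain ⟨z, hz, -⟩ := exists_btrace h (by simpa using hr) hy
  have := (btrace_step (y := leaf s i l) hz PortTree.Trace.nil (adj_leaf s i l)).2
  simp [port] at this

/-- Two steps through port `0` take a `mid` onto an edge of the handle, entered by port `0`, but
take a leaf to the end of the handle by a positive port. -/
theorem not_sameView_mid_leaf {r : ℕ} (hr : 2 ≤ r) {s s' : Bool} {i i' : Fin (δ + 1)}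
    {l : Fin (N s' i')} (h : PortTree.SameView r (broom k δ N) (mid s i : BroomNode k δ N)
      (broom k δ N) (leaf s' i' l : BroomNode k δ N)) : False := by
  obtain ⟨y, hy⟩ := exists_btrace_handle (mid s i : BroomNode k δ N) (btrace_mid s i)
  obtain ⟨z, hz, -⟩ := exists_btrace h (by simpa using hr) hy
  obtain ⟨u, hu⟩ := PortTree.Trace.tail hz
  obtain ⟨rfl, -⟩ := btrace_step (y := leaf s' i' l) hu PortTree.Trace.nil (adj_leaf s' i' l)
  have := (btrace_step (y := mid s' i') hz hu (adj_mid s' i')).2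
  simp [port] at this

/-- Outside the handle only the kind of node and its side must be recognised, because `code` does
not depend on the indices of a `mid` or a leaf. -/
theorem code_eq_of_sameView (hδ : 0 < δ) (hN : ∀ s s', N s = N s' → s = s')
    (x y : BroomNode k δ N)
    (h : PortTree.SameView (2 * k + 3) (broom k δ N) x (broom k δ N) y) : code x = code y := by
  have h' := h.symm
  rcases x with j | ⟨s, i⟩ | ⟨s, i, j⟩ <;> rcases y with j' | ⟨s', i'⟩ | ⟨s', i', j'⟩
  · rw [handle_eq_of_sameView hδ hN h]
  · exact (not_sameView_handle_mid (by omega) h).elim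
  · exact (not_sameView_handle_leaf (by omega) h).elim
  · exact (not_sameView_handle_mid (by omega) h').elim
  · obtain ⟨y, hy, -⟩ := exists_btrace h (by simp) (btrace_mid s i)
    obtain ⟨rfl, -⟩ := btrace_step (y := mid s' i') hy PortTree.Trace.nil (adj_mid s' i')
    rw [hN _ _ (leaves_eq_of_btrace h (by simp) (btrace_mid s i) hy)]
    rfl
  · exact (not_sameView_mid_leaf (by omega) h).elim
  · exact (not_sameView_handle_leaf (by omega) h').elim
  · exact (not_sameView_mid_leaf (by omega) h').elim
  · obtain ⟨y, hy, -⟩ := exists_btrace h (by simp) (btrace_leaf s i j)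
    obtain ⟨u, hu⟩ := PortTree.Trace.tail hy
    obtain ⟨rfl, -⟩ := btrace_step (y := leaf s' i' j') hu PortTree.Trace.nil (adj_leaf s' i' j')
    obtain ⟨rfl, -⟩ := btrace_step (y := mid s' i') hy hu (adj_mid s' i')
    rw [code, hN _ _ (leaves_eq_of_btrace h (by simp) (btrace_leaf s i j) hy)]
    rfl

theorem xi_broom_le (hδ : 0 < δ) (hN : ∀ s s', N s = N s' → s = s') :
    (broom k δ N).xi ≤ ((2 * k + 3 : ℕ) : ℕ∞) :=
  PortTree.xi_le (broom k δ N) _ (handle 0 : BroomNode k δ N) code leadsTo_code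
    (code_eq_of_sameView hδ hN)

/-! ### The half containing the leader -/

/-- The half of a double broom that a node belongs to. -/
def half : BroomNode k δ N → Bool
  | handle j => decide (k < j)
  | mid s _ => s
  | leaf s _ _ => s

theorem half_handleEnd (s : Bool) : half (handle (handleEnd k s) : BroomNode k δ N) = s := by
  cases s <;> simp [half, val_handleEnd]
  omega

theorem onSide_half (y : BroomNode k δ N) : OnSide (half y) y := by
  rcases y with j | ⟨t, i⟩ | ⟨t, i, j⟩ <;> trivial

theorem half_move {s s' : Bool} (h : N s = N' s') (y : BroomNode k δ N) (hy : half y = s) :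
    half (move N' s s' y) = s' := by
  rcases y with j | ⟨t, i⟩ | ⟨t, i, j⟩
  · cases s <;> cases s' <;>
      simp only [half, move, if_true, Bool.true_eq_false, Bool.false_eq_true, if_false,
        Fin.val_rev, decide_eq_true_eq, decide_eq_false_iff_not] at hy ⊢ <;> omega
  · rfl
  · obtain rfl : t = s := hy
    rw [move_leaf h]
    rfl

/-- The endpoint in half `s` of the middle edge of the handle. -/
def middle (k : ℕ) (s : Bool) : Fin (2 * k + 2) :=
  if s then ⟨k + 1, by omega⟩ else ⟨k, by omega⟩

/-- Only the middle edge of the handle joins the two halves. This is the boundary condition needed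
for `SimpleGraph.Walk.IsPath.mem_of_boundary`. -/
theorem eq_middle_of_adj (u v : BroomNode k δ N) (h : (graph k δ N).Adj u v)
    (huv : half v ≠ half u) : u = handle (middle k (half u)) := by
  rcases h with h | h <;>
    rcases isParent_cases h with ⟨j, j', rfl, rfl, hj⟩ | ⟨s, i, rfl, rfl⟩ | ⟨s, i, j, rfl, rfl⟩
  · have h1 : k < (j : ℕ) := by
      by_contra h1
      exact huv (by simp only [half, decide_eq_decide]; omega)
    have h2 : ¬ k < (j' : ℕ) := fun h2 => huv (by simp only [half, decide_eq_decide]; omega)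
    simp only [half, h1, decide_true, middle, if_true]
    congr 1
    apply Fin.ext
    simp only
    omega
  · exact (huv (half_handleEnd s)).elim
  · exact (huv rfl).elim
  · have h1 : k < (j : ℕ) := by
      by_contra h1
      exact huv (by simp only [half, decide_eq_decide]; omega)
    have h2 : ¬ k < (j' : ℕ) := fun h2 => huv (by simp only [half, decide_eq_decide]; omega)
    simp only [half, h2, decide_false, middle, Bool.false_eq_true, if_false]
    congr 1
    apply Fin.ext
    simp only
    omega
  · exact (huv (half_handleEnd s).symm).elim
  · exact (huv rfl).elim

/-- If the same advice makes an algorithm elect leaders in two double brooms sharing a side, then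
these leaders are either both or neither in the half of that side. -/
theorem half_leader_eq {A : PortTree.Algorithm} {w : List Bool} {s s' : Bool}
    (hN : N s = N' s') (h0 : 0 < N s 0) {l : BroomNode k δ N} {l' : BroomNode k δ N'}
    (hl : ∀ x : BroomNode k δ N, ∃ r ≤ 2 * k + 3, ∃ P,
      A.HaltsWith w (broom k δ N) x r P ∧ (broom k δ N).LeadsTo x P l)
    (hl' : ∀ x : BroomNode k δ N', ∃ r ≤ 2 * k + 3, ∃ P,
      A.HaltsWith w (broom k δ N') x r P ∧ (broom k δ N').LeadsTo x P l')
    (h : half l = s) : half l' = s' := by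
  obtain ⟨r, hr, P, hP, p, hp, hpP⟩ := hl (leaf s 0 ⟨0, h0⟩)
  obtain ⟨r', hr', P', hP', p', hp', hpP'⟩ := hl' (leaf s' 0 ⟨0, hN ▸ h0⟩)
  have hPP : P = P' := hP.output_eq hP' hr hr' fun t ht => sameView_leaf hN 0 ⟨0, h0⟩ ht
  have hsupp : ∀ v ∈ p.support, v ∈ {v : BroomNode k δ N | half v = s} := fun v hv =>
    hp.mem_of_boundary {v : BroomNode k δ N | half v = s} (handle (middle k s))
      (fun u v huv hu hv => by
        obtain rfl : half u = s := hu
        exact eq_middle_of_adj u v huv hv)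
      rfl h hv
  -- The path to `l`, confined to its half, is copied into the other broom with the same ports.
  -- Since ports determine the end of a walk, the copy of `l` must be `l'`.
  obtain ⟨q, hq⟩ := PortTree.exists_walk_map (T := broom k δ N) (T' := broom k δ N')
    (move N' s s') {v : BroomNode k δ N | half v = s}
    (fun y z hy hz hyz => move_adj hN y z (by
      obtain rfl : half y = s := hy
      exact onSide_half y) (by
      obtain rfl : half z = s := hz
      exact onSide_half z) hyz) p hsupp
  have key : ∀ (x' : BroomNode k δ N') (q : (broom k δ N').graph.Walk x' (move N' s s' l)),
      x' = leaf s' 0 ⟨0, hN ▸ h0⟩ → (broom k δ N').outPorts q = P → move N' s s' l = l' := by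
    rintro x' q rfl hq
    exact PortTree.eq_of_outPorts_eq (broom k δ N') q p' (hq.trans (hPP.trans hpP'.symm))
  rw [← key _ q (move_leaf hN 0 ⟨0, h0⟩) (hq.trans hpP)]
  exact half_move hN l h

end BroomNode

/-! ### The double brooms `DB_δ(a, b)` and the number of advice strings -/

section DoubleBroom

open BroomNode

variable {k δ : ℕ} {f : Fin (δ ^ δ) ≃ (Fin δ → Fin δ)}

/-- The last entry of `leafCounts` vanishes when all entries of the tuple are maximal, so the
arguments about leaves use index `0`, which for `δ > 0` is not the last one. -/
theorem leafCounts_zero_pos (hδ : 0 < δ) (x : Fin δ → Fin δ) :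
    0 < leafCounts (fun i => (x i : ℕ) + 1) 0 := by
  have h : (0 : Fin (δ + 1)) = Fin.castSucc ⟨0, hδ⟩ := rfl
  rw [h, leafCounts, Fin.snoc_castSucc]
  exact Nat.succ_pos _

theorem leafCounts_injective {x y : Fin δ → Fin δ}
    (h : leafCounts (fun i => (x i : ℕ) + 1) = leafCounts fun i => (y i : ℕ) + 1) : x = y := by
  funext i
  have := congrFun h i.castSucc
  rw [leafCounts, leafCounts, Fin.snoc_castSucc, Fin.snoc_castSucc] at this
  exact Fin.ext (Nat.succ.inj this)

theorem sum_leafCounts (x : Fin δ → Fin δ) :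
    ∑ i, leafCounts (fun i => (x i : ℕ) + 1) i = δ ^ 2 := by
  have h : ∑ i, ((x i : ℕ) + 1) ≤ δ ^ 2 := by
    calc ∑ i, ((x i : ℕ) + 1) ≤ ∑ _i : Fin δ, δ := Finset.sum_le_sum fun i _ => (x i).2
      _ = δ ^ 2 := by simp [sq]
  rw [Fin.sum_univ_castSucc]
  simp only [leafCounts, Fin.snoc_castSucc, Fin.snoc_last]
  omega

theorem diam_doubleBroom (hδ : 0 < δ) (a b : Fin (δ ^ δ)) :
    (doubleBroom k δ f a b).diam = 2 * k + 5 :=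
  diam_broom fun _ => leafCounts_zero_pos hδ _

theorem size_doubleBroom (a b : Fin (δ ^ δ)) :
    (doubleBroom k δ f a b).size = (2 * k + 2) + (2 * (δ + 1) + 2 * δ ^ 2) := by
  rw [doubleBroom, size_broom]
  simp only [sum_leafCounts, Fintype.sum_bool]
  ring

theorem xi_doubleBroom_le (hδ : 0 < δ) {a b : Fin (δ ^ δ)} (hab : a ≠ b) :
    (doubleBroom k δ f a b).xi ≤ ((2 * k + 3 : ℕ) : ℕ∞) := by
  refine xi_broom_le hδ fun s s' h => ?_
  have := f.injective (leafCounts_injective h)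
  cases s <;> cases s'
  · rfl
  · exact (hab this).elim
  · exact (hab this.symm).elim
  · rfl

/-- If an algorithm elects leaders in all double brooms with advice from a set `S`, then `S` has
at least logarithmically many elements in the number of sides. -/
theorem pow_le_two_pow_card (hδ : 0 < δ) (A : PortTree.Algorithm)
    (advice : PortTree → List Bool) (S : Finset (List Bool))
    (hS : ∀ a b, a < b → advice (doubleBroom k δ f a b) ∈ S)
    (hA : ∀ a b, a < b → A.ElectsWithin (advice (doubleBroom k δ f a b))
      (doubleBroom k δ f a b) (2 * k + 3)) : δ ^ δ ≤ 2 ^ S.card := by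
  -- A parameter `c` is coloured for `w` if in some broom with advice `w` the algorithm elects a
  -- leader in the half of `c`.
  let colour : List Bool → Fin (δ ^ δ) → Prop := fun w c =>
    ∃ a b, advice (doubleBroom k δ f a b) = w ∧ ∃ l : (doubleBroom k δ f a b).V,
      (∀ x, ∃ r ≤ 2 * k + 3, ∃ P, A.HaltsWith w (doubleBroom k δ f a b) x r P ∧
        (doubleBroom k δ f a b).LeadsTo x P l) ∧ (if half l then b else a) = c
  have key : ∀ a b, a < b → ∃ s : Bool,
      colour (advice (doubleBroom k δ f a b)) (if s then b else a) ∧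
      ¬ colour (advice (doubleBroom k δ f a b)) (if !s then b else a) := by
    intro a b hab
    obtain ⟨l, hl⟩ := hA a b hab
    refine ⟨half l, ⟨a, b, rfl, l, hl, rfl⟩, ?_⟩
    rintro ⟨a', b', hw, l', hl', hc⟩
    -- If the losing side were coloured too, the broom witnessing this would share that side with
    -- the present one and force `l` into it as well.
    have := half_leader_eq (s := half l') (s' := !half l)
      (congrArg (fun c => leafCounts fun i => (f c i : ℕ) + 1) hc)
      (leafCounts_zero_pos hδ _) hl' hl rfl
    cases h : half l <;> simp [h] at this
  have := card_le_two_pow_of_colouring S (fun a b => advice (doubleBroom k δ f a b)) colour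
    fun a b hab => ⟨hS a b hab, by
      obtain ⟨s, h1, h2⟩ := key a b hab
      cases s
      · exact fun h => h2 (h.1 h1)
      · exact fun h => h2 (h.2 h1)⟩
  simpa using this

end DoubleBroom

/-! ### Diameter 3: double stars -/

/-- The nodes of a double star: two adjacent centres, where the centre on side `s` is adjacent to
`m s` leaves. -/
inductive StarNode (m : Bool → ℕ) : Type
  | centre (s : Bool) : StarNode m
  | leaf (s : Bool) (i : Fin (m s)) : StarNode m

namespace StarNode

variable {m : Bool → ℕ} {t t' : ℕ}

/-- The orientation of the edges of a double star towards `centre false`. -/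
def IsParent : StarNode m → StarNode m → Prop
  | centre s, centre s' => s = true ∧ s' = false
  | leaf s _, centre s' => s = s'
  | _, _ => False

/-- The underlying graph of a double star. -/
def graph (m : Bool → ℕ) : SimpleGraph (StarNode m) where
  Adj u v := IsParent u v ∨ IsParent v u
  symm := ⟨fun _ _ h => h.symm⟩
  loopless := ⟨by rintro (s | ⟨s, i⟩) <;> simp [IsParent]⟩

theorem adj_centre (s : Bool) : (graph m).Adj (centre s) (centre !s) := by
  cases s
  · exact Or.inr ⟨rfl, rfl⟩
  · exact Or.inl ⟨rfl, rfl⟩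

theorem adj_leaf (s : Bool) (i : Fin (m s)) : (graph m).Adj (leaf s i) (centre s) := Or.inl rfl

theorem eq_of_adj_leaf {s : Bool} {i : Fin (m s)} {u : StarNode m}
    (h : (graph m).Adj (leaf s i) u) : u = centre s := by
  rcases u with s' | ⟨s', i'⟩
  · exact congrArg centre (h.resolve_right id).symm
  · exact (h.elim id id).elim

theorem eq_of_adj_centre {s : Bool} {u : StarNode m} (h : (graph m).Adj (centre s) u) :
    u = centre (!s) ∨ ∃ i, u = leaf s i := by
  rcases u with s' | ⟨s', i⟩
  · rcases h with ⟨rfl, rfl⟩ | ⟨rfl, rfl⟩ <;> exact Or.inl rfl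
  · obtain rfl : s' = s := h.resolve_left id
    exact Or.inr ⟨i, rfl⟩

/-- The port numbers of a double star in which the edge between the centres has port `t` at both
centres. -/
def port (t : ℕ) : StarNode m → StarNode m → ℕ
  | centre _, centre _ => t
  | centre _, leaf _ i => if (i : ℕ) < t then i else i + 1
  | _, _ => 0

instance : Finite (StarNode m) := by
  let F : Bool ⊕ (Σ s : Bool, Fin (m s)) → StarNode m := fun x => match x with
    | .inl s => centre s
    | .inr q => leaf q.1 q.2
  refine Finite.of_surjective F ?_
  rintro (s | ⟨s, i⟩)
  · exact ⟨.inl s, rfl⟩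
  · exact ⟨.inr ⟨s, i⟩, rfl⟩

theorem graph_isTree (m : Bool → ℕ) : (graph m).IsTree := by
  refine BroomNode.isTree_of_parent _ IsParent (centre false)
    (fun u => match u with
      | centre s => s.toNat
      | leaf _ _ => 2) (fun _ _ => Iff.rfl) ?_ ?_ ?_ ?_
  · rintro (s | ⟨s, i⟩) (s' | ⟨s', i'⟩) h
    · obtain ⟨rfl, rfl⟩ := h
      exact Nat.one_pos
    · exact h.elim
    · exact Nat.lt_succ_of_le (Bool.toNat_le s')
    · exact h.elim
  · rintro (s | ⟨s, i⟩) <;> simp [IsParent]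
  · rintro (s | ⟨s, i⟩) h
    · cases s
      · exact (h rfl).elim
      · exact ⟨centre false, rfl, rfl⟩
    · exact ⟨centre s, rfl⟩
  · rintro (s | ⟨s, i⟩) (s' | ⟨s', i'⟩) (s'' | ⟨s'', i''⟩) h h' <;>
      first
      | exact h.elim
      | exact h'.elim
      | exact congrArg centre (h.2.trans h'.2.symm)
      | exact congrArg centre (h.symm.trans h')

theorem exists_leaf_port {s : Bool} {p : ℕ} (ht : t ≤ m s) (hp : p ≤ m s) (hpt : p ≠ t) :
    ∃ i, port t (centre s) (leaf s i : StarNode m) = p := by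
  rcases lt_or_gt_of_ne hpt with h | h
  · exact ⟨⟨p, by omega⟩, if_pos h⟩
  · refine ⟨⟨p - 1, by omega⟩, (if_neg (by simp only; omega)).trans ?_⟩
    simp only
    omega

theorem exists_centre_port (ht : ∀ s, t ≤ m s) (s : Bool) (p : ℕ) (hp : p < m s + 1) :
    ∃ u : StarNode m, (graph m).Adj (centre s) u ∧ port t (centre s) u = p := by
  by_cases hpt : p = t
  · exact ⟨centre !s, adj_centre s, hpt.symm⟩
  · obtain ⟨i, hi⟩ := exists_leaf_port (ht s) (Nat.lt_succ_iff.1 hp) hpt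
    exact ⟨leaf s i, (adj_leaf s i).symm, hi⟩

theorem port_centre_lt (ht : ∀ s, t ≤ m s) (s : Bool) (u : StarNode m)
    (h : (graph m).Adj (centre s) u) : port t (centre s) u < m s + 1 := by
  rcases eq_of_adj_centre h with rfl | ⟨i, rfl⟩
  · exact Nat.lt_succ_of_le (ht s)
  · simp only [port]
    split_ifs <;> omega

theorem le_ncard (t : ℕ) (v : StarNode m) (d : ℕ)
    (h : ∀ p < d, ∃ u, (graph m).Adj v u ∧ port t v u = p) :
    d ≤ ((graph m).neighborSet v).ncard := by
  have h1 : Set.Iio d ⊆ port t v '' (graph m).neighborSet v := by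
    intro p hp
    obtain ⟨u, hu, hp⟩ := h p hp
    exact ⟨u, hu, hp⟩
  have h2 := Set.ncard_le_ncard h1 (Set.toFinite _)
  have h3 := Set.ncard_image_le (f := port t v) (Set.toFinite ((graph m).neighborSet v))
  rw [← Finset.coe_Iio, Set.ncard_coe_finset, Nat.card_Iio] at h2
  omega

/-- The double star with `m s` leaves on side `s`, in which the edge between the centres has port
`t` at both centres. -/
def doubleStar (m : Bool → ℕ) (t : ℕ) (ht : ∀ s, t ≤ m s) : PortTree where
  V := StarNode m
  finite := inferInstance
  graph := graph m
  isTree := graph_isTree m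
  port := port t
  port_lt := by
    rintro (s | ⟨s, i⟩) u hu
    · exact (port_centre_lt ht s u hu).trans_le
        (le_ncard t _ _ fun p hp => exists_centre_port ht s p hp)
    · refine lt_of_lt_of_le Nat.one_pos (le_ncard t _ _ fun p hp => ?_)
      obtain rfl : p = 0 := by omega
      exact ⟨centre s, adj_leaf s i, rfl⟩
  port_inj := by
    rintro (s | ⟨s, i⟩) u w hu hw h
    · rcases eq_of_adj_centre hu with rfl | ⟨i, rfl⟩ <;>
        rcases eq_of_adj_centre hw with rfl | ⟨j, rfl⟩
      · rfl
      · simp only [port] at h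
        split_ifs at h <;> omega
      · simp only [port] at h
        split_ifs at h <;> omega
      · simp only [port] at h
        congr 1
        apply Fin.ext
        split_ifs at h <;> omega
    · exact (eq_of_adj_leaf hu).trans (eq_of_adj_leaf hw).symm

variable {ht : ∀ s, t ≤ m s} {ht' : ∀ s, t' ≤ m s}

theorem degree_centre (s : Bool) :
    (doubleStar m t ht).degree (centre s : StarNode m) = m s + 1 :=
  PortTree.degree_eq_of_ports _ _ _ (exists_centre_port ht s) (port_centre_lt ht s)

theorem degree_leaf (s : Bool) (i : Fin (m s)) :
    (doubleStar m t ht).degree (leaf s i : StarNode m) = 1 := by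
  refine PortTree.degree_eq_of_ports _ _ _ (fun p hp => ?_) fun u hu => ?_
  · obtain rfl : p = 0 := by omega
    exact ⟨(centre s : StarNode m), adj_leaf s i, rfl⟩
  · exact Nat.one_pos

/-- The distance from the leaves on side `false`, up to a constant on side `false`. -/
def height : StarNode m → ℕ
  | centre s => if s then 2 else 1
  | leaf s _ => if s then 3 else 0

theorem height_le_of_adj (u v : StarNode m) (h : (graph m).Adj u v) :
    height v ≤ height u + 1 := by
  rcases u with s | ⟨s, i⟩
  · rcases eq_of_adj_centre h with rfl | ⟨i, rfl⟩ <;> cases s <;> simp [height]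
  · rw [eq_of_adj_leaf h]
    cases s <;> simp [height]

/-- The side that a node belongs to. -/
def side : StarNode m → Bool
  | centre s => s
  | leaf s _ => s

theorem dist_centre_side_le (u : StarNode m) : (graph m).dist u (centre (side u)) ≤ 1 := by
  rcases u with s | ⟨s, i⟩
  · simp [side]
  · exact (SimpleGraph.dist_eq_one_iff_adj.2 (adj_leaf s i)).le

theorem dist_centre_centre_le (s s' : Bool) : (graph m).dist (centre s) (centre s') ≤ 1 := by
  by_cases h : s' = s
  · simp [h]
  · obtain rfl : s' = !s := by cases s <;> cases s' <;> simp at h ⊢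
    exact (SimpleGraph.dist_eq_one_iff_adj.2 (adj_centre s)).le

theorem diam_doubleStar (hm : ∀ s, 0 < m s) : (doubleStar m t ht).diam = 3 := by
  refine PortTree.diam_eq_of_dist _ _ ?_ (leaf false ⟨0, hm _⟩ : StarNode m)
    (leaf true ⟨0, hm _⟩ : StarNode m) ?_
  · intro (u : StarNode m) (v : StarNode m)
    change (graph m).dist u v ≤ _
    have hc := (graph_isTree m).connected
    have h1 := dist_centre_side_le u
    have h2 := dist_centre_side_le v
    rw [SimpleGraph.dist_comm] at h2
    have h3 := dist_centre_centre_le (m := m) (side u) (side v)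
    have h4 := hc.dist_triangle (u := u) (v := centre (side u)) (w := centre (side v))
    have h5 := hc.dist_triangle (u := u) (v := centre (side v)) (w := v)
    omega
  · have := (graph_isTree m).connected.le_add_dist height height_le_of_adj
      (leaf false ⟨0, hm _⟩) (leaf true ⟨0, hm _⟩)
    simp only [height, if_true, Bool.false_eq_true, if_false, zero_add] at this
    exact this

theorem size_doubleStar : (doubleStar m t ht).size = 2 + ∑ s, m s := by
  let e : StarNode m ≃ Bool ⊕ (Σ s : Bool, Fin (m s)) :=
    { toFun := fun x => match x with
        | centre s => .inl s
        | leaf s i => .inr ⟨s, i⟩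
      invFun := fun x => match x with
        | .inl s => centre s
        | .inr q => leaf q.1 q.2
      left_inv := by rintro (s | ⟨s, i⟩) <;> rfl
      right_inv := by rintro (s | ⟨s, i⟩) <;> rfl }
  change Nat.card (StarNode m) = _
  rw [Nat.card_congr e, Nat.card_eq_fintype_card]
  simp only [Fintype.card_sum, Fintype.card_sigma, Fintype.card_fin, Fintype.card_bool]

/-- The outgoing ports on the way from a node to `centre false`. -/
def code (t : ℕ) : StarNode m → List ℕ
  | centre s => if s then [t] else []
  | leaf s _ => 0 :: if s then [t] else []

/-- The distance from `centre false`. -/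
def rank : StarNode m → ℕ
  | centre s => if s then 1 else 0
  | leaf s _ => if s then 2 else 1

theorem rank_le_of_adj (u v : StarNode m) (h : (graph m).Adj u v) : rank v ≤ rank u + 1 := by
  rcases u with s | ⟨s, i⟩
  · rcases eq_of_adj_centre h with rfl | ⟨i, rfl⟩ <;> cases s <;> simp [rank]
  · rw [eq_of_adj_leaf h]
    cases s <;> simp [rank]

theorem rank_le_dist (u : StarNode m) : rank u ≤ (graph m).dist u (centre false) := by
  have := (graph_isTree m).connected.le_add_dist rank rank_le_of_adj (centre false) u
  rw [SimpleGraph.dist_comm]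
  simpa [rank] using this

theorem exists_walk_code (x : StarNode m) :
    ∃ p : (doubleStar m t ht).graph.Walk x (centre false : StarNode m),
      p.length = rank x ∧ (doubleStar m t ht).outPorts p = code t x := by
  have hc : ∀ s, ∃ p : (doubleStar m t ht).graph.Walk (centre s : StarNode m)
      (centre false : StarNode m), p.length = rank (centre s : StarNode m) ∧
        (doubleStar m t ht).outPorts p = code t (centre s : StarNode m) := by
    intro s
    cases s
    · exact ⟨SimpleGraph.Walk.nil, rfl, rfl⟩
    · exact PortTree.exists_walk_cons (T := doubleStar m t ht) (adj_centre true)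
        ⟨SimpleGraph.Walk.nil, rfl, rfl⟩
  rcases x with s | ⟨s, i⟩
  · exact hc s
  · have := PortTree.exists_walk_cons (T := doubleStar m t ht) (adj_leaf s i) (hc s)
    cases s <;> exact this

theorem leadsTo_code (x : StarNode m) :
    (doubleStar m t ht).LeadsTo x (code t x) (centre false : StarNode m) := by
  obtain ⟨p, hp, hp'⟩ := exists_walk_code (ht := ht) x
  exact ⟨p, p.isPath_of_length_eq_dist
    (le_antisymm (hp.le.trans (rank_le_dist x)) (SimpleGraph.dist_le p)), hp'⟩

theorem code_eq_of_sameView (hm : ∀ s, 0 < m s) (hne : m false ≠ m true) (x y : StarNode m)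
    (h : PortTree.SameView 1 (doubleStar m t ht) x (doubleStar m t ht) y) :
    code t x = code t y := by
  have hside : ∀ {s s'}, m s = m s' → s = s' := by
    intro s s' hs
    cases s <;> cases s'
    · rfl
    · exact (hne hs).elim
    · exact (hne hs.symm).elim
    · rfl
  -- The empty trace compares the degrees of `x` and `y`. This separates centres from leaves and, by
  -- `hne`, the centres from each other; a leaf needs the one round to learn the degree of its
  -- centre.
  obtain ⟨z, hz, hd⟩ := h.trace (Nat.zero_le _) PortTree.Trace.nil
  obtain rfl : y = z := PortTree.Trace.unique (T := doubleStar m t ht) PortTree.Trace.nil hz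
  rcases x with s | ⟨s, i⟩ <;> rcases y with s' | ⟨s', i'⟩
  · rw [degree_centre, degree_centre] at hd
    rw [hside (Nat.succ.inj hd)]
  · rw [degree_centre, degree_leaf] at hd
    have := hm s
    omega
  · rw [degree_centre, degree_leaf] at hd
    have := hm s'
    omega
  · obtain ⟨z, hz, hd⟩ := h.trace le_rfl
      (PortTree.Trace.cons (T := doubleStar m t ht) PortTree.Trace.nil (adj_leaf s i))
    obtain ⟨rfl, -⟩ := PortTree.Trace.step (T := doubleStar m t ht) hz PortTree.Trace.nil
      (adj_leaf s' i') rfl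
    rw [degree_centre, degree_centre] at hd
    obtain rfl := hside (Nat.succ.inj hd)
    rfl

theorem xi_doubleStar_le (hm : ∀ s, 0 < m s) (hne : m false ≠ m true) :
    (doubleStar m t ht).xi ≤ ((1 : ℕ) : ℕ∞) :=
  PortTree.xi_le (doubleStar m t ht) _ (centre false : StarNode m) (code t) leadsTo_code
    (code_eq_of_sameView hm hne)

theorem eq_or_eq_of_dist_leaf_le {s : Bool} {i : Fin (m s)} {y : StarNode m}
    (h : (graph m).dist (leaf s i) y ≤ 1) : y = leaf s i ∨ y = centre s := by
  rcases Nat.le_one_iff_eq_zero_or_eq_one.1 h with h | h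
  · exact Or.inl ((graph_isTree m).connected.dist_eq_zero_iff.1 h).symm
  · exact Or.inr (eq_of_adj_leaf (SimpleGraph.dist_eq_one_iff_adj.1 h))

/-- The view of a leaf after one round depends only on its port at the centre and on the degree of
the centre. -/
theorem sameView_leaf {s : Bool} {i i' : Fin (m s)}
    (h : port t (centre s) (leaf s i : StarNode m) = port t' (centre s) (leaf s i' : StarNode m))
    {r : ℕ} (hr : r ≤ 1) :
    PortTree.SameView r (doubleStar m t ht) (leaf s i : StarNode m) (doubleStar m t' ht')
      (leaf s i' : StarNode m) := by
  classical
  let g : Fin (m s) → Fin (m s) → StarNode m → StarNode m := fun i i' y =>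
    if y = leaf s i then leaf s i' else centre s
  have hl : ∀ i i', g i i' (leaf s i) = leaf s i' := fun i i' => if_pos rfl
  have hc : ∀ i i', g i i' (centre s) = centre s := fun i i' => if_neg (by simp)
  have hb : ∀ (i : Fin (m s)) (y : StarNode m), (graph m).dist (leaf s i) y ≤ r →
      y = leaf s i ∨ y = centre s := fun i y hy => eq_or_eq_of_dist_leaf_le (hy.trans hr)
  have hinv : ∀ (i i' : Fin (m s)) (y : StarNode m), (graph m).dist (leaf s i) y ≤ r →
      g i' i (g i i' y) = y := by
    intro i i' y hy
    rcases hb i y hy with rfl | rfl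
    · rw [hl, hl]
    · rw [hc, hc]
  have hadj : ∀ (i i' : Fin (m s)) (y z : StarNode m), (graph m).dist (leaf s i) y ≤ r →
      (graph m).dist (leaf s i) z ≤ r → (graph m).Adj y z →
      (graph m).Adj (g i i' y) (g i i' z) := by
    intro i i' y z hy hz hyz
    rcases hb i y hy with rfl | rfl <;> rcases hb i z hz with rfl | rfl
    · exact (hyz.ne rfl).elim
    · rw [hl, hc]
      exact adj_leaf s i'
    · rw [hl, hc]
      exact (adj_leaf s i').symm
    · exact (hyz.ne rfl).elim
  refine PortTree.sameView_of_maps (T := doubleStar m t ht) (T' := doubleStar m t' ht')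
    (g i i') (g i' i) (hl i i') (hl i' i) (hinv i i') (hinv i' i)
    (fun y z hy hz hyz => ⟨hadj i i' y z hy hz hyz, ?_⟩) (hadj i' i) fun y hy => ?_
  · change port t y z = port t' (g i i' y) (g i i' z)
    rcases hb i y hy with rfl | rfl <;> rcases hb i z hz with rfl | rfl
    · rw [hl]
      rfl
    · rw [hl, hc]
      rfl
    · rw [hl, hc]
      exact h
    · exact (hyz.ne rfl).elim
  · rcases hb i y hy with rfl | rfl
    · rw [hl, degree_leaf, degree_leaf]
    · rw [hc, degree_centre, degree_centre]

/-- The way from a leaf to the other side starts with the ports `0` and `t`. -/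
theorem exists_eq_cons_of_leadsTo {s : Bool} {i : Fin (m s)} {P : List ℕ} {l : StarNode m}
    (h : (doubleStar m t ht).LeadsTo (leaf s i : StarNode m) P l) (hl : side l ≠ s) :
    ∃ R, P = 0 :: t :: R := by
  obtain ⟨p, hp, rfl⟩ := h
  change (graph m).Walk (leaf s i) l at p
  cases p with
  | nil => exact (hl rfl).elim
  | @cons _ u _ hu p =>
    obtain rfl := eq_of_adj_leaf hu
    have hp' := (SimpleGraph.Walk.cons_isPath_iff _ _).1 hp
    cases p with
    | nil => exact (hl rfl).elim
    | @cons _ v _ hv p =>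
      rcases eq_of_adj_centre hv with rfl | ⟨j, rfl⟩
      · exact ⟨_, rfl⟩
      -- A detour to another leaf is a dead end: the path would have to return to the centre or stop
      -- on side `s`.
      · have hp'' := (SimpleGraph.Walk.cons_isPath_iff _ _).1 hp'.1
        cases p with
        | nil => exact (hl rfl).elim
        | @cons _ w _ hw p =>
          obtain rfl := eq_of_adj_leaf hw
          exact (hp''.2 (List.mem_cons_of_mem _ p.start_mem_support)).elim

/-- If the same advice makes an algorithm elect leaders on the same side of two double stars of
the same shape, then these double stars have the same ports. -/
theorem port_eq_of_leaders {A : PortTree.Algorithm} {w : List Bool} (hm : ∀ s, 2 ≤ m s)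
    {l l' : StarNode m}
    (hl : ∀ x : StarNode m, ∃ r ≤ 1, ∃ P,
      A.HaltsWith w (doubleStar m t ht) x r P ∧ (doubleStar m t ht).LeadsTo x P l)
    (hl' : ∀ x : StarNode m, ∃ r ≤ 1, ∃ P,
      A.HaltsWith w (doubleStar m t' ht') x r P ∧ (doubleStar m t' ht').LeadsTo x P l')
    (h : side l = side l') : t = t' := by
  -- One of the ports `0`, `1`, `2` avoids both `t` and `t'`, and so belongs to a leaf in both
  -- stars. On the side without the leader this leaf has the same view in both, but must output `t`
  -- in one and `t'` in the other.
  obtain ⟨p, hp2, hp, hp'⟩ : ∃ p ≤ 2, p ≠ t ∧ p ≠ t' := by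
    by_contra! hcon
    have h0 := hcon 0
    have h1 := hcon 1
    have h2 := hcon 2
    omega
  let s := !side l
  have hs : side l ≠ s := by simp [s]
  obtain ⟨i, hi⟩ := exists_leaf_port (ht s) (hp2.trans (hm s)) hp
  obtain ⟨i', hi'⟩ := exists_leaf_port (ht' s) (hp2.trans (hm s)) hp'
  obtain ⟨r, hr, P, hP, hPl⟩ := hl (leaf s i)
  obtain ⟨r', hr', P', hP', hPl'⟩ := hl' (leaf s i')
  obtain rfl : P = P' := hP.output_eq hP' hr hr' fun q hq => sameView_leaf (hi.trans hi'.symm) hq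
  obtain ⟨R, hR⟩ := exists_eq_cons_of_leadsTo hPl hs
  obtain ⟨R', hR'⟩ := exists_eq_cons_of_leadsTo hPl' (h ▸ hs)
  rw [hR] at hR'
  simp only [List.cons.injEq, true_and] at hR'
  exact hR'.1

/-- If an algorithm elects leaders in all double stars of a shape with advice from a set `S`, then
`S` has at least half as many elements as there are such double stars. -/
theorem le_two_mul_card {d : ℕ} (hm : ∀ s, 2 ≤ m s) (hd : ∀ t : Fin d, ∀ s, (t : ℕ) ≤ m s)
    (A : PortTree.Algorithm) (advice : PortTree → List Bool) (S : Finset (List Bool))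
    (hS : ∀ t : Fin d, advice (doubleStar m t (hd t)) ∈ S)
    (hA : ∀ t : Fin d, A.ElectsWithin (advice (doubleStar m t (hd t)))
      (doubleStar m t (hd t)) 1) : d ≤ 2 * S.card := by
  choose l hl using hA
  -- The advice together with the side of the leader determines `t`.
  have := Finset.card_le_card_of_injOn (s := (Finset.univ : Finset (Fin d)))
    (t := S ×ˢ (Finset.univ : Finset Bool))
    (fun t => (advice (doubleStar m t (hd t)), side (l t)))
    (fun t _ => by simpa using hS t) fun t _ t' _ h => by
      obtain ⟨h1, h2⟩ := Prod.ext_iff.1 h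
      simp only at h1 h2
      have hl' := hl t'
      rw [← h1] at hl'
      exact Fin.ext (port_eq_of_leaders hm (hl t) hl' h2)
  simpa [mul_comm] using this

end StarNode

/-! ### Choice of parameters and constants -/

theorem log_div_eight_le {n L : ℕ} (hn : 0 < n) (h : n ≤ 2 ^ (8 * L)) :
    1 / 8 * Real.log n ≤ L := by
  have h1 : Real.log n ≤ Real.log ((2 : ℝ) ^ (8 * L)) :=
    Real.log_le_log (by exact_mod_cast hn) (by exact_mod_cast h)
  rw [Real.log_pow] at h1
  have h2 : Real.log 2 ≤ 1 := by
    have := Real.log_two_lt_d9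
    linarith
  have h3 : ((8 * L : ℕ) : ℝ) * Real.log 2 ≤ (8 * L : ℕ) * 1 := by gcongr
  push_cast at h1 h3
  linarith

theorem exists_doubleStar_class (n : ℕ) (hn : 3 < n) :
    ∃ 𝒯 : Set PortTree,
      (∀ T ∈ 𝒯, (1 / 2 : ℝ) * n ≤ T.size ∧ (T.size : ℝ) ≤ 6 * n ∧ T.diam = 3 ∧
        T.xi ≤ ((1 : ℕ) : ℕ∞)) ∧
      ∀ (A : PortTree.Algorithm) (advice : PortTree → List Bool),
        (∀ T ∈ 𝒯, A.ElectsWithin (advice T) T 1) →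
        ∃ T ∈ 𝒯, 1 / 8 * Real.log n ≤ ((advice T).length : ℝ) := by
  -- Unequal sides make the centres distinguishable, and at least `n` leaves on each side leave room
  -- for `n + 1` values of the port `t`.
  let m : Bool → ℕ := fun s => if s then n + 1 else n
  have hm : ∀ s, n ≤ m s := fun s => by cases s <;> simp [m]
  have hd : ∀ t : Fin (n + 1), ∀ s, (t : ℕ) ≤ m s := fun t s =>
    (Nat.lt_succ_iff.1 t.2).trans (hm s)
  refine ⟨Set.range fun t : Fin (n + 1) => StarNode.doubleStar m t (hd t), ?_, ?_⟩
  · rintro _ ⟨t, rfl⟩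
    have hsize : (StarNode.doubleStar m t (hd t)).size = 2 * n + 3 := by
      rw [StarNode.size_doubleStar]
      simp [m]
      ring
    have hn' : (4 : ℝ) ≤ n := by exact_mod_cast hn
    simp only [hsize]
    push_cast
    exact ⟨by linarith, by linarith,
      StarNode.diam_doubleStar fun s => (by omega : 0 < n).trans_le (hm s),
      StarNode.xi_doubleStar_le (fun s => (by omega : 0 < n).trans_le (hm s)) (by simp [m])⟩
  · intro A advice hA
    by_contra! hlt
    obtain ⟨S, hS, hcard⟩ := exists_strings_of_length_lt (Nat.log 2 (n + 1) - 1)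
    have hmem : ∀ t : Fin (n + 1), advice (StarNode.doubleStar m t (hd t)) ∈ S := by
      intro t
      apply hS
      have h1 := hlt _ ⟨t, rfl⟩
      set L := (advice (StarNode.doubleStar m t (hd t))).length
      by_contra h2
      have h3 : n + 1 < 2 ^ (L + 2) := Nat.lt_pow_of_log_lt one_lt_two (by omega)
      -- An empty string would give `n + 1 < 4`. For `L ≥ 1` the additive constant in the exponent
      -- is absorbed by the factor `8`.
      have h4 : 1 ≤ L := by
        by_contra h5
        obtain h5 : L = 0 := by omega
        rw [h5] at h3
        omega
      have h5 : 2 ^ (L + 2) ≤ 2 ^ (8 * L) := Nat.pow_le_pow_right two_pos (by omega)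
      exact absurd (log_div_eight_le (by omega) (by omega : n ≤ 2 ^ (8 * L))) (not_le.2 h1)
    have h1 := StarNode.le_two_mul_card (fun s => (by omega : 2 ≤ n).trans (hm s)) hd A advice S
      hmem fun t => hA _ ⟨t, rfl⟩
    have h2 : 2 ^ Nat.log 2 (n + 1) ≤ n + 1 := Nat.pow_log_le_self 2 (by omega)
    have h3 : 1 ≤ Nat.log 2 (n + 1) := Nat.log_pos one_lt_two (by omega)
    obtain ⟨e, he⟩ := Nat.exists_eq_add_of_le' h3
    rw [he, Nat.add_sub_cancel] at hcard
    rw [he, pow_succ] at h2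
    omega

/-- With `δ = ⌊√n⌋` the two sides have `2 * δ ^ 2` leaves, of order `n`, while the handle adds fewer
than `n` nodes. The bijection `f` may be arbitrary. -/
theorem doubleBroomClass_spec (k n δ : ℕ) (f : Fin (δ ^ δ) ≃ (Fin δ → Fin δ)) (hn : 2 * k + 5 < n)
    (hδ : δ = Nat.sqrt n) :
    (∀ T ∈ doubleBroomClass (2 * k + 5) δ f,
      (1 / 2 : ℝ) * n ≤ T.size ∧ (T.size : ℝ) ≤ 6 * n ∧ T.diam = 2 * k + 5 ∧
        T.xi ≤ ((2 * k + 3 : ℕ) : ℕ∞)) ∧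
      ∀ (A : PortTree.Algorithm) (advice : PortTree → List Bool),
        (∀ T ∈ doubleBroomClass (2 * k + 5) δ f, A.ElectsWithin (advice T) T (2 * k + 3)) →
        ∃ T ∈ doubleBroomClass (2 * k + 5) δ f,
          1 / 8 * Real.log n ≤ ((advice T).length : ℝ) := by
  have hδ2 : 2 ≤ δ := by
    rw [hδ, Nat.le_sqrt]
    omega
  have hle : δ ^ 2 ≤ n := by
    rw [hδ]
    exact Nat.sqrt_le' n
  have hlt : n < (δ + 1) ^ 2 := by
    rw [hδ]
    exact Nat.lt_succ_sqrt' n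
  constructor
  · rintro _ ⟨k', a, b, hk, hab, rfl⟩
    obtain rfl : k = k' := by omega
    refine ⟨?_, ?_, diam_doubleBroom (by omega) a b, xi_doubleBroom_le (by omega) hab.ne⟩
    · rw [size_doubleBroom]
      have h : n ≤ 2 * (2 * k + 2 + (2 * (δ + 1) + 2 * δ ^ 2)) := by nlinarith
      have h' : (n : ℝ) ≤ 2 * ((2 * k + 2 + (2 * (δ + 1) + 2 * δ ^ 2) : ℕ) : ℝ) := by
        exact_mod_cast h
      linarith
    · rw [size_doubleBroom]
      have h : 2 * k + 2 + (2 * (δ + 1) + 2 * δ ^ 2) ≤ 6 * n := by nlinarith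
      exact_mod_cast h
  · intro A advice hA
    by_contra! hshort
    -- There are fewer than `δ` strings of length below `log₂ δ`, whereas `2 ^ δ ≤ δ ^ δ` shows that
    -- at least `δ` are needed.
    obtain ⟨S, hS, hcard⟩ := exists_strings_of_length_lt (Nat.log 2 δ)
    have hmem : ∀ a b, a < b → advice (doubleBroom k δ f a b) ∈ S := by
      intro a b hab
      apply hS
      have h1 := hshort _ ⟨k, a, b, rfl, hab, rfl⟩
      set L := (advice (doubleBroom k δ f a b)).length
      by_contra h2
      have h3 : δ < 2 ^ (L + 1) := Nat.lt_pow_of_log_lt one_lt_two (by omega)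
      have h4 : 1 ≤ L := by
        by_contra h5
        obtain h5 : L = 0 := by omega
        rw [h5] at h3
        omega
      have h5 : n ≤ 2 ^ (8 * L) := calc
        n ≤ (δ + 1) ^ 2 := hlt.le
        _ ≤ (2 ^ (L + 1)) ^ 2 := Nat.pow_le_pow_left h3 2
        _ = 2 ^ ((L + 1) * 2) := (pow_mul _ _ _).symm
        _ ≤ 2 ^ (8 * L) := Nat.pow_le_pow_right two_pos (by omega)
      exact absurd (log_div_eight_le (by omega) h5) (not_le.2 h1)
    have h1 := pow_le_two_pow_card (by omega) A advice S hmem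
      fun a b hab => hA _ ⟨k, a, b, rfl, hab, rfl⟩
    have h2 : S.card < δ := hcard.trans_le (Nat.pow_log_le_self 2 (by omega))
    have h3 : 2 ^ S.card < 2 ^ δ := Nat.pow_lt_pow_right one_lt_two h2
    have h4 : 2 ^ δ ≤ δ ^ δ := Nat.pow_le_pow_left hδ2 δ
    omega

theorem theorem4 :
    ∃ c₁ c₂ c₃ : ℝ, 0 < c₁ ∧ 0 < c₂ ∧ 0 < c₃ ∧
      ∀ D n : ℕ, Odd D → 3 ≤ D → D < n →
        ∃ 𝒯 : Set PortTree,
          -- for `D ≥ 5` the class consists of double brooms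
          (5 ≤ D → ∃ (δ : ℕ) (f : Fin (δ ^ δ) ≃ (Fin δ → Fin δ)), 𝒯 = doubleBroomClass D δ f) ∧
          -- size `Θ(n)`, diameter `D`, and `ξ(T) ≤ D - 2`
          (∀ T ∈ 𝒯, c₁ * n ≤ T.size ∧ T.size ≤ c₂ * n ∧ T.diam = D ∧
            T.xi ≤ ((D - 2 : ℕ) : ℕ∞)) ∧
          -- every algorithm with advice electing a leader in time `D - 2` on the whole class
          -- receives advice of size at least `c₃ * log n` on some tree of the class
          (∀ (A : PortTree.Algorithm) (advice : PortTree → List Bool),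
            (∀ T ∈ 𝒯, A.ElectsWithin (advice T) T (D - 2)) →
            ∃ T ∈ 𝒯, c₃ * Real.log n ≤ ((advice T).length : ℝ)) := by
  refine ⟨1 / 2, 6, 1 / 8, by norm_num, by norm_num, by norm_num, fun D n hD h3 hn => ?_⟩
  by_cases h5 : 5 ≤ D
  · obtain ⟨k, rfl⟩ : ∃ k, D = 2 * k + 5 := by
      obtain ⟨j, rfl⟩ := hD
      exact ⟨j - 2, by omega⟩
    let f : Fin (n.sqrt ^ n.sqrt) ≃ (Fin n.sqrt → Fin n.sqrt) := finFunctionFinEquiv.symm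
    exact ⟨doubleBroomClass (2 * k + 5) n.sqrt f, fun _ => ⟨_, f, rfl⟩,
      doubleBroomClass_spec k n _ f hn rfl⟩
  · obtain rfl : D = 3 := by
      obtain ⟨j, rfl⟩ := hD
      omega
    obtain ⟨𝒯, h⟩ := exists_doubleStar_class n hn
    exact ⟨𝒯, fun h => absurd h h5, h⟩
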